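/- Let $X=(X_t)_{t\in\mathbb Z}$ be a (strictly) stationary max-stable time series with standard $\alpha$-Fréchet margins, $\alpha>0$: for every $k\ge1$ there are functions $a_k>0$, $b_k$ on $\mathbb Z$ such that the pointwise maximum of $k$ independent copies of $X$ has the law of $(a_k(t)X_t+b_k(t))_{t\in\mathbb Z}$, and $\mathbb P(X_t\le x)=\exp(-x^{-\alpha})$ for $x>0$. For finite $S\subset\mathbb Z$ let $\theta_S=-\log\mathbb P(X_t\le 1\ \forall t\in S)$ be the extremal coefficient, put $\theta_h=\theta_{\{0,h\}}$ and $p(u)=\mathbb P(X_0>u)$, and assume $\sum_{t=1}^\infty(2-\theta_t)<\infty$. Let $T\subset\{0,1,2,\dots\}$ be finite with $0\in T$, let $\mathbf X_t=(X_{t+s})_{s\in T}$, $$C_0=\{x\in(0,\infty)^T: x_0>1\},\qquad C_T=\{x\in(0,\infty)^T: x_s>1\ \forall s\in T\},$$ and, for a real sequence $(u_n)$, let $$\widehat\chi_{T,n}=\frac{\frac1n\sum_{t=1}^n \mathbf 1\{u_n^{-1}\mathbf X_t\in C_T\}}{\frac1n\sum_{t=1}^n \mathbf 1\{u_n^{-1}\mathbf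 X_t\in C_0\}}$$ (with value $0$ if the denominator vanishes). Then, for every finite nonempty $S\subset\mathbb Z$, the limit $$\chi_S=\lim_{u\to\infty}\frac{\mathbb P(X_t>u\ \forall t\in S)}{p(u)}$$ exists, the series $$\sigma^2=\sum_{h\in\mathbb Z}\Big(\chi_{T\cup(h+T)}-2\,\chi_T\,\chi_{T\cup\{h\}}+\chi_T^2\,\chi_{\{0,h\}}\Big)$$ converges absolutely to a finite number $\sigma^2\ge0$, and for every sequence $u_n\to\infty$ with $n\,p(u_n)\to\infty$, $$\sqrt{n\,p(u_n)}\Big(\widehat\chi_{T,n}-\frac{\mathbb P(u_n^{-1}\mathbf X_0\in C_T)}{\mathbb P(u_n^{-1}\mathbf X_0\in C_0)}\Big)\xrightarrow{d}\mathcal N(0,\sigma^2)\qquad(n\to\infty).$$ If in addition $n\,p(u_n)^3\to0$, then also $$\sqrt{n\,p(u_n)}\,\big(\widehat\chi_{T,n}-\chi_T\big)\xrightarrow{d}\mathcal N(0,\sigma^2)\qquad(n\to\infty).$$ Here $\mathcal N(0,0)$ denotes the point mass at $0$. -/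

import Mathlib

open MeasureTheory ProbabilityTheory Filter Topology
open scoped NNReal

noncomputable section

/-- The time series `X = (X t)` indexed by `t ∈ ℤ` is (strictly) stationary: every time shift of `X`
has the same law on the path space `ℤ → ℝ` as `X` itself. -/
def IsStationarySeries {Ω : Type*} [MeasurableSpace Ω] (P : Measure Ω) (X : ℤ → Ω → ℝ) : Prop :=
  ∀ h : ℤ, IdentDistrib (fun ω (t : ℤ) => X (t + h) ω) (fun ω (t : ℤ) => X t ω) P P

/-- The time series `X` is max-stable: for every `n ≥ 1` there are normalizing functions
`a n > 0` and `b n` such that the pointwise maximum of `n` independent copies of `X` has the same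
law, as a random path in `ℤ → ℝ`, as `t ↦ a n t * X t + b n t`. -/
def IsMaxStableSeries {Ω : Type*} [MeasurableSpace Ω] (P : Measure Ω) (X : ℤ → Ω → ℝ) : Prop :=
  ∀ n : ℕ, 1 ≤ n → ∃ a b : ℤ → ℝ, (∀ t, 0 < a t) ∧
    (Measure.pi (fun _ : Fin n => P.map (fun ω (t : ℤ) => X t ω))).map
        (fun (y : Fin n → ℤ → ℝ) (t : ℤ) => ⨆ i, y i t) =
      P.map (fun ω (t : ℤ) => a t * X t ω + b t)

/-- All one-dimensional margins of `X` are standard `α`-Fréchet: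
`P (X t ≤ x) = exp (- x ^ (-α))` for all `x > 0`. -/
def HasFrechetMargins {Ω : Type*} [MeasurableSpace Ω] (P : Measure Ω) (X : ℤ → Ω → ℝ)
    (α : ℝ) : Prop :=
  ∀ t : ℤ, ∀ x : ℝ, 0 < x → P.real {ω | X t ω ≤ x} = Real.exp (-x ^ (-α))

/-- The extremal coefficient `θ_S` of a finite set of times `S`: the exponent measure of the
complement of the unit cube `[0, 1]^S`, that is `- log P (X t ≤ 1 for all t ∈ S)`. -/
def extremalCoeff {Ω : Type*} [MeasurableSpace Ω] (P : Measure Ω) (X : ℤ → Ω → ℝ)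
    (S : Finset ℤ) : ℝ :=
  -Real.log (P.real {ω | ∀ t ∈ S, X t ω ≤ 1})

/-- The exceedance probability `p(u) = P (X_0 > u)`. -/
def exceedProb {Ω : Type*} [MeasurableSpace Ω] (P : Measure Ω) (X : ℤ → Ω → ℝ) (u : ℝ) : ℝ :=
  P.real {ω | u < X 0 ω}

/-- The pre-asymptotic tail dependence ratio `P (X t > u for all t ∈ S) / P (X_0 > u)`. -/
def tailRatio {Ω : Type*} [MeasurableSpace Ω] (P : Measure Ω) (X : ℤ → Ω → ℝ)
    (S : Finset ℤ) (u : ℝ) : ℝ :=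
  P.real {ω | ∀ t ∈ S, u < X t ω} / exceedProb P X u

/-- The tail dependence coefficient
`χ_S = lim_{u → ∞} P (X t > u for all t ∈ S) / P (X_0 > u)`. -/
def tailCoeff {Ω : Type*} [MeasurableSpace Ω] (P : Measure Ω) (X : ℤ → Ω → ℝ)
    (S : Finset ℤ) : ℝ :=
  limUnder atTop (tailRatio P X S)

/-- The random vector `(X_{t+s})_{s ∈ T}`. -/
def obsWindow {Ω : Type*} (X : ℤ → Ω → ℝ) (T : Finset ℤ) (t : ℤ) (ω : Ω) : T → ℝ :=
  fun s => X (t + s) ω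

/-- The set `C_0`: all coordinates are positive and the coordinate with index `0` exceeds `1`. -/
def baseSet (T : Finset ℤ) : Set (T → ℝ) :=
  {x | (∀ s, 0 < x s) ∧ ∀ s : T, (s : ℤ) = 0 → 1 < x s}

/-- The set `C_T`: all coordinates are positive and every coordinate exceeds `1`. -/
def jointSet (T : Finset ℤ) : Set (T → ℝ) :=
  {x | (∀ s, 0 < x s) ∧ ∀ s, 1 < x s}

/-- The relative frequency `n⁻¹ ∑_{t=1}^n 1{u⁻¹ (X_{t+s})_{s ∈ T} ∈ C}`. -/
def relFreq {Ω : Type*} (X : ℤ → Ω → ℝ) (T : Finset ℤ) (C : Set (T → ℝ)) (u : ℝ) (n : ℕ)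
    (ω : Ω) : ℝ :=
  (1 / (n : ℝ)) * ∑ t ∈ Finset.Icc 1 n,
    Set.indicator {ω' | u⁻¹ • obsWindow X T (t : ℤ) ω' ∈ C} (fun _ => (1 : ℝ)) ω

/-- The ratio estimator of `χ_T` at level `u` (with value `0` if its denominator vanishes). -/
def chiHat {Ω : Type*} (X : ℤ → Ω → ℝ) (T : Finset ℤ) (u : ℝ) (n : ℕ) (ω : Ω) : ℝ :=
  relFreq X T (jointSet T) u n ω / relFreq X T (baseSet T) u n ω

/-- The pre-asymptotic centering
`P (u⁻¹ (X_s)_{s ∈ T} ∈ C_T) / P (u⁻¹ (X_s)_{s ∈ T} ∈ C_0)`. -/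
def chiCentering {Ω : Type*} [MeasurableSpace Ω] (P : Measure Ω) (X : ℤ → Ω → ℝ)
    (T : Finset ℤ) (u : ℝ) : ℝ :=
  P.real {ω | u⁻¹ • obsWindow X T 0 ω ∈ jointSet T} /
    P.real {ω | u⁻¹ • obsWindow X T 0 ω ∈ baseSet T}

/-- The lag-`h` term of the asymptotic variance:
`χ_{T ∪ (h + T)} - 2 χ_T χ_{T ∪ {h}} + χ_T² χ_{{0, h}}`. -/
def varTerm {Ω : Type*} [MeasurableSpace Ω] (P : Measure Ω) (X : ℤ → Ω → ℝ)
    (T : Finset ℤ) (h : ℤ) : ℝ :=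
  tailCoeff P X (T ∪ T.image (fun s => h + s))
    - 2 * tailCoeff P X T * tailCoeff P X (T ∪ {h})
    + tailCoeff P X T ^ 2 * tailCoeff P X {0, h}

end

/-!
Max-stability with standard Fréchet margins forces the normalization `a k = k ^ (1/α)`, `b k = 0`,
so that, at the level `u = x ^ (-1/α)`, `P (X t ≤ u for all t ∈ S) = exp (-x θ_S)` for every
finite `S` (`measureReal_forall_le_level`). Inclusion–exclusion turns this into the existence of
the tail dependence coefficients, with an error of order `x`, and gives
`χ_{0,h} = 2 - θ_h`.

The same formula says that the random set of exceedance times in a finite window, at parameter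
`x + y`, is distributed as the union of independent exceedance sets at the parameters `x` and `y`
(`setMean_exceedWeight_add`). Writing the exceedance set at `x` as a union of `k` independent sets
at `x / k` and applying the law of total covariance `k` times, only pairs of times hit by the same
small piece matter as `k → ∞`. This yields a covariance inequality for Lipschitz functions of the
exceedances, bounded by `x` times a sum of pairwise tail dependence coefficients
(`IsUnionSemigroup.norm_setCov_le`, `norm_integral_mul_sub_le`). It takes the place of mixing
conditions.

The error of the ratio estimator is the sum of the scores `J_t - π D_t`, with `J_t` the indicator
of a joint exceedance on `t + T`, `D_t` that of an exceedance at `t` and `π` the ratio of their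
means, divided by the number of exceedances. For characteristic functions of the normalized sums,
the covariance inequality shows that cutting off a block of fixed length `r` costs `o(r) / n`,
uniformly in the length of the rest, because the pairwise coefficients are summable. Blocks of
fixed length have an elementary second-order expansion whose variance is, per unit length, close
to `σ²` for large `r` by Cesàro's theorem. Letting first `n` and then `r` tend to infinity gives
the Gaussian limit (`tendsto_of_block_factorization`, `tendstoInDistribution_sum_score`). The same
covariance inequality bounds the variance of the number of exceedances by the order of its mean,
so the denominator is asymptotically deterministic (`tendstoInMeasure_exceedCount_div`) and
Slutsky's theorem applies. Replacing the centring by its limit costs `√(n p) * O(p)`, which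
vanishes if `n p³ → 0`.
-/

/-! ### Finite-dimensional laws on the diagonal -/

section Margins

variable {Ω : Type*} [MeasurableSpace Ω] {P : Measure Ω} [IsProbabilityMeasure P] {X : ℤ → Ω → ℝ}
  {α : ℝ}

lemma measurableSet_forall_le (hX : ∀ t, Measurable (X t)) (S : Finset ℤ) (c : ℤ → ℝ) :
    MeasurableSet {ω | ∀ t ∈ S, X t ω ≤ c t} := by
  have : {ω | ∀ t ∈ S, X t ω ≤ c t} = ⋂ t ∈ S, {ω | X t ω ≤ c t} := by ext; simp
  rw [this]
  exact S.measurableSet_biInter fun t _ => measurableSet_le (hX t) measurable_const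

lemma measurableSet_forall_gt (hX : ∀ t, Measurable (X t)) (S : Finset ℤ) (u : ℝ) :
    MeasurableSet {ω | ∀ t ∈ S, u < X t ω} := by
  have : {ω | ∀ t ∈ S, u < X t ω} = ⋂ t ∈ S, {ω | u < X t ω} := by ext; simp
  rw [this]
  exact S.measurableSet_biInter fun t _ => measurableSet_lt measurable_const (hX t)

/-- Max-stability read off on boxes. -/
lemma pow_measureReal_box_eq {k : ℕ} (hk : 1 ≤ k) (hX : ∀ t, Measurable (X t)) {a b : ℤ → ℝ}
    (h : (Measure.pi (fun _ : Fin k => P.map (fun ω (t : ℤ) => X t ω))).map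
        (fun (y : Fin k → ℤ → ℝ) (t : ℤ) => ⨆ i, y i t) =
      P.map (fun ω (t : ℤ) => a t * X t ω + b t)) (S : Finset ℤ) (c : ℤ → ℝ) :
    P.real {ω | ∀ t ∈ S, X t ω ≤ c t} ^ k = P.real {ω | ∀ t ∈ S, a t * X t ω + b t ≤ c t} := by
  have : Nonempty (Fin k) := ⟨⟨0, hk⟩⟩
  have hpath : Measurable fun ω (t : ℤ) => X t ω := measurable_pi_lambda _ hX
  have : IsProbabilityMeasure (P.map (fun ω (t : ℤ) => X t ω)) :=
    Measure.isProbabilityMeasure_map hpath.aemeasurable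
  have hB : MeasurableSet {y : ℤ → ℝ | ∀ t ∈ S, y t ≤ c t} :=
    measurableSet_forall_le (X := fun t (y : ℤ → ℝ) => y t) (fun t => measurable_pi_apply t) S c
  have hsup : Measurable (fun (y : Fin k → ℤ → ℝ) (t : ℤ) => ⨆ i, y i t) := by
    refine measurable_pi_lambda _ fun t => Measurable.iSup fun i => ?_
    fun_prop
  have hl : Measurable (fun ω (t : ℤ) => a t * X t ω + b t) :=
    measurable_pi_lambda _ fun t => ((hX t).const_mul _).add_const _
  have key := congrArg (fun m => m {y : ℤ → ℝ | ∀ t ∈ S, y t ≤ c t}) h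
  rw [Measure.map_apply hsup hB, Measure.map_apply hl hB] at key
  have hpre : (fun (y : Fin k → ℤ → ℝ) (t : ℤ) => ⨆ i, y i t) ⁻¹'
      {y : ℤ → ℝ | ∀ t ∈ S, y t ≤ c t} =
      Set.univ.pi (fun _ : Fin k => {y : ℤ → ℝ | ∀ t ∈ S, y t ≤ c t}) := by
    ext y
    simp only [Set.mem_preimage, Set.mem_ofPred_eq, Set.mem_pi, Set.mem_univ, true_imp_iff]
    constructor
    · intro hy i t ht
      exact (le_ciSup (f := fun i => y i t) (Set.finite_range _).bddAbove i).trans (hy t ht)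
    · exact fun hy t ht => ciSup_le fun i => hy i t ht
  rw [hpre, Measure.pi_pi] at key
  simp only [Finset.prod_const, Finset.card_univ, Fintype.card_fin] at key
  rw [Measure.map_apply hpath hB] at key
  rw [measureReal_def, measureReal_def, ← ENNReal.toReal_pow]
  exact congrArg ENNReal.toReal key

/-- Fréchet variables are almost surely positive: the distribution function vanishes up to `0`,
since it tends to `0` at `0` from the right. -/
lemma measureReal_le_eq_zero (hα : 0 < α) (hmarg : HasFrechetMargins P X α) (t : ℤ) {z : ℝ}
    (hz : z ≤ 0) : P.real {ω | X t ω ≤ z} = 0 := by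
  have h1 : Tendsto (fun x : ℝ => Real.exp (-x ^ (-α))) (𝓝[>] 0) (𝓝 0) :=
    Real.tendsto_exp_atBot.comp (tendsto_neg_atTop_atBot.comp
      (tendsto_rpow_neg_nhdsGT_zero (by linarith)))
  refine le_antisymm (ge_of_tendsto h1 ?_) measureReal_nonneg
  filter_upwards [self_mem_nhdsWithin] with x hx
  rw [← hmarg t x hx]
  exact measureReal_mono fun ω (h : X t ω ≤ z) => h.trans (hz.trans (le_of_lt hx))

/-- The normalizing functions in the max-stability of Fréchet margins are forced:
`b = 0` and `a ^ α = k`. -/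
lemma normalizing_eq (hα : 0 < α) (hmarg : HasFrechetMargins P X α) {k : ℕ} (hk : 1 ≤ k)
    {t : ℤ} {a b : ℝ} (ha : 0 < a)
    (h : ∀ c : ℝ, P.real {ω | X t ω ≤ c} ^ k = P.real {ω | a * X t ω + b ≤ c}) :
    b = 0 ∧ a = (k : ℝ) ^ (1 / α) := by
  have h' : ∀ c : ℝ, P.real {ω | X t ω ≤ c} ^ k = P.real {ω | X t ω ≤ (c - b) / a} := by
    intro c
    rw [h c]
    congr 1
    ext ω
    simp only [Set.mem_ofPred_eq]
    rw [le_div_iff₀ ha]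
    constructor <;> intro h <;> linarith
  have hpos : ∀ x : ℝ, 0 < x → 0 < P.real {ω | X t ω ≤ x} := fun x hx => by
    rw [hmarg t x hx]; exact Real.exp_pos _
  -- the left endpoint of the support is `0` on one side and `b` on the other
  have hb : b = 0 := by
    rcases lt_trichotomy b 0 with hb | hb | hb
    · have h0 := h' 0
      rw [measureReal_le_eq_zero hα hmarg t le_rfl, zero_pow (by omega)] at h0
      have := hpos ((0 - b) / a) (div_pos (by linarith) ha)
      linarith
    · exact hb
    · have h0 := h' b
      rw [sub_self, zero_div, measureReal_le_eq_zero hα hmarg t le_rfl] at h0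
      exact absurd h0 (pow_pos (hpos b hb) k).ne'
  refine ⟨hb, ?_⟩
  have h1 := h' a
  rw [hb, sub_zero, div_self ha.ne', hmarg t a ha, hmarg t 1 one_pos, ← Real.exp_nat_mul,
    Real.exp_eq_exp, Real.one_rpow, Real.rpow_neg ha.le] at h1
  have hak : (k : ℝ) = a ^ α := by
    have := Real.rpow_pos_of_pos ha α
    field_simp at h1
    linarith
  rw [hak, ← Real.rpow_mul ha.le, mul_one_div_cancel hα.ne', Real.rpow_one]

/-- Probability that the coordinates in `S` all stay below the level `x ^ (-1/α)`, the level whose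
one-dimensional exceedance probability is `1 - exp (-x)`. -/
lemma diag_pow_eq (hX : ∀ t, Measurable (X t)) (hα : 0 < α) (hmax : IsMaxStableSeries P X)
    (hmarg : HasFrechetMargins P X α) (S : Finset ℤ) {k : ℕ} (hk : 1 ≤ k) {x : ℝ} (hx : 0 < x) :
    P.real {ω | ∀ t ∈ S, X t ω ≤ x ^ (-1 / α)} ^ k =
      P.real {ω | ∀ t ∈ S, X t ω ≤ (k * x) ^ (-1 / α)} := by
  obtain ⟨a, b, ha, hab⟩ := hmax k hk
  have hk0 : (0 : ℝ) < k := by exact_mod_cast hk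
  have hbox := pow_measureReal_box_eq hk hX hab
  have hnorm : ∀ t, b t = 0 ∧ a t = (k : ℝ) ^ (1 / α) := fun t =>
    normalizing_eq hα hmarg hk (ha t) fun c => by simpa using hbox {t} (fun _ => c)
  rw [hbox S (fun _ => x ^ (-1 / α))]
  congr 1
  ext ω
  refine forall₂_congr fun t _ => ?_
  rw [(hnorm t).1, (hnorm t).2, add_zero, Real.mul_rpow hk0.le hx.le, neg_div,
    Real.rpow_neg hk0.le, mul_comm, ← le_div_iff₀ (Real.rpow_pos_of_pos hk0 _), div_eq_inv_mul]

/-- A monotone function on the half-line commuting with multiplication by positive integers is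
linear. -/
lemma eq_mul_of_monotone_of_natMul {L : ℝ → ℝ} (hmono : ∀ x y, 0 < x → x ≤ y → L x ≤ L y)
    (hmul : ∀ k : ℕ, 1 ≤ k → ∀ x, 0 < x → L (k * x) = k * L x) {x : ℝ} (hx : 0 < x) :
    L x = x * L 1 := by
  have hL1 : 0 ≤ L 1 := by
    have h1 := hmul 2 (by norm_num) 1 one_pos
    have h2 := hmono 1 ((2 : ℕ) * 1) one_pos (by norm_num)
    rw [h1] at h2
    push_cast at h2
    linarith
  -- compare `k * x` with its integer neighbours
  have hbound : ∀ k : ℕ, 1 ≤ k → |L x - x * L 1| * k ≤ L 1 := by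
    intro k hk
    have hk0 : (0 : ℝ) < k := by exact_mod_cast hk
    have hkx : 0 < k * x := mul_pos hk0 hx
    have hup : k * L x ≤ (k * x + 1) * L 1 := by
      have h1 := hmono (k * x) ((⌊k * x⌋₊ + 1 : ℕ) * 1) hkx (by
        push_cast; rw [mul_one]; exact (Nat.lt_floor_add_one _).le)
      rw [hmul k hk x hx, hmul _ (by omega) 1 one_pos] at h1
      push_cast at h1
      nlinarith [Nat.floor_le hkx.le]
    have hlow : (k * x - 1) * L 1 ≤ k * L x := by
      rcases Nat.eq_zero_or_pos ⌊k * x⌋₊ with h0 | h0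
      · have hlt : k * x < 1 := Nat.floor_eq_zero.1 h0
        have hLkx : 0 ≤ L (k * x) := by
          have h1 := hmul 2 (by norm_num) (k * x) hkx
          have h2 := hmono (k * x) ((2 : ℕ) * (k * x)) hkx (by push_cast; linarith)
          rw [h1] at h2
          push_cast at h2
          linarith
        rw [hmul k hk x hx] at hLkx
        nlinarith
      · have h1 := hmono ((⌊k * x⌋₊ : ℕ) * 1) (k * x) (by simpa using h0) (by
          rw [mul_one]; exact Nat.floor_le hkx.le)
        rw [hmul k hk x hx, hmul _ h0 1 one_pos] at h1
        nlinarith [Nat.lt_floor_add_one (k * x)]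
    rw [← abs_of_pos hk0, ← abs_mul, abs_le]
    constructor <;> nlinarith
  by_contra hne
  have hpos : 0 < |L x - x * L 1| := abs_pos.2 (sub_ne_zero.2 hne)
  obtain ⟨k, hk⟩ := exists_nat_gt (L 1 / |L x - x * L 1|)
  rw [div_lt_iff₀ hpos] at hk
  have h1 := hbound (k + 1) (by omega)
  push_cast at h1
  nlinarith

lemma rpow_level_rpow {x : ℝ} (hα : 0 < α) (hx : 0 < x) : (x ^ (-1 / α)) ^ (-α) = x := by
  rw [← Real.rpow_mul hx.le, div_mul_eq_mul_div, neg_mul_neg, one_mul, div_self hα.ne',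
    Real.rpow_one]

lemma rpow_rpow_level {u : ℝ} (hα : 0 < α) (hu : 0 < u) : (u ^ (-α)) ^ (-1 / α) = u := by
  rw [← Real.rpow_mul hu.le, mul_div_assoc', neg_mul_neg, mul_one, div_self hα.ne', Real.rpow_one]

/-- The diagonal finite-dimensional laws are governed by the extremal coefficients. -/
theorem measureReal_forall_le_level (hX : ∀ t, Measurable (X t)) (hα : 0 < α)
    (hmax : IsMaxStableSeries P X) (hmarg : HasFrechetMargins P X α) (S : Finset ℤ) {x : ℝ}
    (hx : 0 < x) :
    P.real {ω | ∀ t ∈ S, X t ω ≤ x ^ (-1 / α)} = Real.exp (-x * extremalCoeff P X S) := by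
  -- `-log H` is monotone and commutes with multiplication by positive integers, hence linear;
  -- `H` has no zeros because `H x = H (x / k) ^ k` and `H (x / k)` tends to `1`
  set H : ℝ → ℝ := fun x => P.real {ω | ∀ t ∈ S, X t ω ≤ x ^ (-1 / α)} with hH
  have hanti : ∀ x y, 0 < x → x ≤ y → H y ≤ H x := fun x y hx hxy =>
    measureReal_mono fun ω h t ht => (h t ht).trans
      (Real.rpow_le_rpow_of_nonpos hx hxy (by
        rw [neg_div]; exact neg_nonpos.2 (one_div_pos.2 hα).le))
  have hpow : ∀ k : ℕ, 1 ≤ k → ∀ x, 0 < x → H x ^ k = H (k * x) := fun k hk x hx =>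
    diag_pow_eq hX hα hmax hmarg S hk hx
  have hlow : ∀ x, 0 < x → 1 - S.card * x ≤ H x := by
    intro x hx
    have hcompl : {ω | ∀ t ∈ S, X t ω ≤ x ^ (-1 / α)}ᶜ =
        ⋃ t ∈ S, {ω | X t ω ≤ x ^ (-1 / α)}ᶜ := by
      ext ω; simp
    have h1 : P.real {ω | ∀ t ∈ S, X t ω ≤ x ^ (-1 / α)}ᶜ ≤ S.card * x := by
      rw [hcompl]
      refine (measureReal_biUnion_finset_le _ _).trans ?_
      rw [← nsmul_eq_mul]
      refine Finset.sum_le_card_nsmul _ _ _ fun t _ => ?_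
      rw [probReal_compl_eq_one_sub (measurableSet_le (hX t) measurable_const),
        hmarg t _ (Real.rpow_pos_of_pos hx _), rpow_level_rpow hα hx]
      linarith [Real.add_one_le_exp (-x)]
    rw [probReal_compl_eq_one_sub (measurableSet_forall_le hX S fun _ => x ^ (-1 / α))] at h1
    linarith
  have hpos : ∀ x, 0 < x → 0 < H x := by
    intro x hx
    obtain ⟨k, hk⟩ := exists_nat_gt (S.card * x)
    have hk0 : (0 : ℝ) < k := lt_of_le_of_lt (by positivity) hk
    have h1 := hpow k (by exact_mod_cast hk0) (x / k) (div_pos hx hk0)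
    rw [mul_div_cancel₀ _ hk0.ne'] at h1
    rw [← h1]
    refine pow_pos (lt_of_lt_of_le ?_ (hlow _ (div_pos hx hk0))) k
    rw [mul_div_assoc', sub_pos, div_lt_one hk0]
    exact hk
  have hlin := eq_mul_of_monotone_of_natMul (L := fun x => -Real.log (H x))
    (fun x y hx hxy => neg_le_neg (Real.log_le_log (hpos y (hx.trans_le hxy)) (hanti x y hx hxy)))
    (fun k hk x hx => by
      rw [← hpow k hk x hx, Real.log_pow]; ring) hx
  have h1 : -Real.log (H 1) = extremalCoeff P X S := by
    simp [hH, extremalCoeff]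
  rw [h1] at hlin
  change H x = _
  rw [← Real.exp_log (hpos x hx)]
  congr 1
  linarith

end Margins

/-! ### Tail dependence coefficients -/

section Shift

variable {Ω : Type*} [MeasurableSpace Ω] {P : Measure Ω} {X : ℤ → Ω → ℝ} {α : ℝ}

lemma extremalCoeff_singleton (hmarg : HasFrechetMargins P X α) (t : ℤ) :
    extremalCoeff P X {t} = 1 := by
  simp [extremalCoeff, hmarg t 1 one_pos]

lemma measureReal_shift (hstat : IsStationarySeries P X) {B : Set (ℤ → ℝ)} (hB : MeasurableSet B)
    (h : ℤ) : P.real {ω | (fun t => X (t + h) ω) ∈ B} = P.real {ω | (fun t => X t ω) ∈ B} := by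
  have := (hstat h).measure_mem_eq hB
  exact congrArg ENNReal.toReal this

lemma tailRatio_image_add (hstat : IsStationarySeries P X) (S : Finset ℤ) (h : ℤ) (u : ℝ) :
    tailRatio P X (S.image (fun s => h + s)) u = tailRatio P X S u := by
  have h1 := measureReal_shift hstat (measurableSet_forall_gt
    (X := fun t (y : ℤ → ℝ) => y t) (fun t => measurable_pi_apply t) S u) h
  rw [tailRatio, tailRatio]
  congr 1
  refine Eq.trans ?_ h1
  congr 1
  ext ω
  simp only [Set.mem_ofPred_eq, Finset.forall_mem_image, add_comm h]

lemma tailCoeff_image_add (hstat : IsStationarySeries P X) (S : Finset ℤ) (h : ℤ) :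
    tailCoeff P X (S.image (fun s => h + s)) = tailCoeff P X S := by
  rw [tailCoeff, tailCoeff]
  congr 1
  ext u
  exact tailRatio_image_add hstat S h u

lemma tailCoeff_pair_eq (hstat : IsStationarySeries P X) (s t : ℤ) :
    tailCoeff P X {s, t} = tailCoeff P X {0, t - s} := by
  rw [← tailCoeff_image_add hstat {0, t - s} s]
  simp

lemma tailCoeff_pair_neg (hstat : IsStationarySeries P X) (h : ℤ) :
    tailCoeff P X {0, -h} = tailCoeff P X {0, h} := by
  rw [← tailCoeff_image_add hstat {0, -h} h]
  simp [Finset.pair_comm]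

end Shift

section TailCoeff

variable {Ω : Type*} [MeasurableSpace Ω] {P : Measure Ω} [IsProbabilityMeasure P] {X : ℤ → Ω → ℝ}
  {α : ℝ}

/-- Inclusion–exclusion for joint exceedances. -/
lemma measureReal_forall_gt_eq_sum (hX : ∀ t, Measurable (X t)) (S : Finset ℤ) (u : ℝ) :
    P.real {ω | ∀ t ∈ S, u < X t ω} =
      ∑ A ∈ S.powerset, (-1) ^ A.card * P.real {ω | ∀ t ∈ A, X t ω ≤ u} := by
  classical
  have hpt : ∀ ω, Set.indicator {ω | ∀ t ∈ S, u < X t ω} (1 : Ω → ℝ) ω =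
      ∑ A ∈ S.powerset, (-1) ^ A.card *
        Set.indicator {ω | ∀ t ∈ A, X t ω ≤ u} (1 : Ω → ℝ) ω := by
    intro ω
    have hprod : ∀ A : Finset ℤ, Set.indicator {ω | ∀ t ∈ A, X t ω ≤ u} (1 : Ω → ℝ) ω =
        ∏ t ∈ A, if X t ω ≤ u then (1 : ℝ) else 0 := fun A => by
      rw [Finset.prod_ite_zero]; simp [Set.indicator_apply]
    simp_rw [hprod, ← Finset.prod_const, ← Finset.prod_mul_distrib]
    rw [← Finset.prod_one_add]
    have : ∀ t ∈ S, (1 + -1 * (if X t ω ≤ u then (1 : ℝ) else 0)) =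
        if u < X t ω then (1 : ℝ) else 0 := fun t _ => by
      by_cases h : X t ω ≤ u
      · simp [h, not_lt.2 h]
      · simp [h, not_le.1 h]
    rw [Finset.prod_congr rfl this, Finset.prod_ite_zero]
    simp [Set.indicator_apply]
  rw [← integral_indicator_one (measurableSet_forall_gt hX S u)]
  simp_rw [hpt]
  rw [integral_finsetSum]
  · refine Finset.sum_congr rfl fun A _ => ?_
    rw [integral_const_mul, integral_indicator_one (measurableSet_forall_le hX A fun _ => u)]
  · exact fun A _ => ((integrable_const (1 : ℝ)).indicator
      (measurableSet_forall_le hX A fun _ => u)).const_mul _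

lemma extremalCoeff_nonneg (S : Finset ℤ) : 0 ≤ extremalCoeff P X S :=
  neg_nonneg.2 (Real.log_nonpos measureReal_nonneg measureReal_le_one)

lemma extremalCoeff_empty : extremalCoeff P X ∅ = 0 := by simp [extremalCoeff]

lemma abs_exp_neg_sub_le {y : ℝ} (hy : 0 ≤ y) : |Real.exp (-y) - 1 + y| ≤ y ^ 2 / 2 := by
  have h1 := Real.add_one_le_exp (-y)
  have h2 := Real.quadratic_le_exp_of_nonneg hy
  have h3 : Real.exp (-y) * Real.exp y = 1 := by rw [← Real.exp_add]; simp
  have h4 := Real.exp_pos (-y)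
  rw [abs_of_nonneg (by linarith)]
  have h5 : Real.exp (-y) * (1 + y + y ^ 2 / 2) ≤ 1 := by nlinarith
  by_contra hcon
  push Not at hcon
  nlinarith [sq_nonneg (y ^ 2), mul_pos (show (0 : ℝ) < 1 + y + y ^ 2 / 2 by positivity)
    (sub_pos.2 hcon)]

lemma exceedProb_level (hX : ∀ t, Measurable (X t)) (hα : 0 < α)
    (hmarg : HasFrechetMargins P X α) {x : ℝ} (hx : 0 < x) :
    exceedProb P X (x ^ (-1 / α)) = 1 - Real.exp (-x) := by
  have h : {ω | x ^ (-1 / α) < X 0 ω} = {ω | X 0 ω ≤ x ^ (-1 / α)}ᶜ := by ext; simp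
  rw [exceedProb, h, probReal_compl_eq_one_sub (measurableSet_le (hX 0) measurable_const),
    hmarg 0 _ (Real.rpow_pos_of_pos hx _), rpow_level_rpow hα hx]

lemma half_le_one_sub_exp {x : ℝ} (hx : 0 < x) (hx1 : x ≤ 1) : x / 2 ≤ 1 - Real.exp (-x) := by
  have := (abs_le.1 (abs_exp_neg_sub_le hx.le)).2
  nlinarith

lemma one_sub_exp_le {x : ℝ} : 1 - Real.exp (-x) ≤ x := by
  linarith [Real.add_one_le_exp (-x)]

/-- The joint exceedance ratio at the level `x ^ (-1/α)` differs from the alternating sum of the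
extremal coefficients only by `O(x)`. -/
lemma exists_abs_tailRatio_sub_sum_le (hX : ∀ t, Measurable (X t)) (hα : 0 < α)
    (hmax : IsMaxStableSeries P X) (hmarg : HasFrechetMargins P X α) {S : Finset ℤ}
    (hS : S.Nonempty) :
    ∃ K, ∀ x, 0 < x → x ≤ 1 → |tailRatio P X S (x ^ (-1 / α)) -
      (-∑ A ∈ S.powerset, (-1) ^ A.card * extremalCoeff P X A)| ≤ K * x := by
  set c := -∑ A ∈ S.powerset, (-1) ^ A.card * extremalCoeff P X A with hc
  set C := ∑ A ∈ S.powerset, extremalCoeff P X A ^ 2 / 2 with hC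
  refine ⟨2 * C + |c|, fun x hx hx1 => ?_⟩
  have hJ : |P.real {ω | ∀ t ∈ S, x ^ (-1 / α) < X t ω} - x * c| ≤ C * x ^ 2 := by
    rw [measureReal_forall_gt_eq_sum hX]
    have h0 : ∑ A ∈ S.powerset, (-1 : ℝ) ^ A.card = 0 := by
      have := Finset.sum_powerset_neg_one_pow_card_of_nonempty hS
      exact_mod_cast this
    have h1 : ∑ A ∈ S.powerset, (-1) ^ A.card * P.real {ω | ∀ t ∈ A, X t ω ≤ x ^ (-1 / α)} -
        x * c = ∑ A ∈ S.powerset, (-1 : ℝ) ^ A.card * (Real.exp (-(x * extremalCoeff P X A)) - 1 +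
          x * extremalCoeff P X A) := by
      have : x * c = -∑ A ∈ S.powerset, (-1) ^ A.card * (x * extremalCoeff P X A) := by
        rw [hc, mul_neg, Finset.mul_sum]
        congr 1
        exact Finset.sum_congr rfl fun A _ => by ring
      rw [this, sub_neg_eq_add, ← Finset.sum_add_distrib, ← sub_zero (∑ A ∈ S.powerset, _), ← h0,
        ← Finset.sum_sub_distrib]
      refine Finset.sum_congr rfl fun A _ => ?_
      rw [measureReal_forall_le_level hX hα hmax hmarg A hx, neg_mul]
      ring
    rw [h1, hC, Finset.sum_mul]
    refine (Finset.abs_sum_le_sum_abs _ _).trans (Finset.sum_le_sum fun A _ => ?_)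
    rw [abs_mul, abs_pow, abs_neg, abs_one, one_pow, one_mul]
    refine (abs_exp_neg_sub_le (mul_nonneg hx.le (extremalCoeff_nonneg A))).trans (le_of_eq ?_)
    ring
  have hp := half_le_one_sub_exp hx hx1
  have hp' := (abs_exp_neg_sub_le hx.le)
  rw [tailRatio, exceedProb_level hX hα hmarg hx]
  have hp0 : 0 < 1 - Real.exp (-x) := by linarith
  rw [div_sub' hp0.ne', abs_div, abs_of_pos hp0, div_le_iff₀ hp0]
  calc |P.real {ω | ∀ t ∈ S, x ^ (-1 / α) < X t ω} - (1 - Real.exp (-x)) * c|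
      = |(P.real {ω | ∀ t ∈ S, x ^ (-1 / α) < X t ω} - x * c) +
          (Real.exp (-x) - 1 + x) * c| := by congr 1; ring
    _ ≤ C * x ^ 2 + x ^ 2 / 2 * |c| := by
        refine (abs_add_le _ _).trans (add_le_add hJ ?_)
        rw [abs_mul]
        exact mul_le_mul_of_nonneg_right hp' (abs_nonneg _)
    _ = (2 * C + |c|) * x * (x / 2) := by ring
    _ ≤ (2 * C + |c|) * x * (1 - Real.exp (-x)) := by
        have : 0 ≤ C := Finset.sum_nonneg fun A _ => by positivity
        exact mul_le_mul_of_nonneg_left hp (by positivity)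

lemma tendsto_level_atTop (hα : 0 < α) :
    Tendsto (fun x : ℝ => x ^ (-1 / α)) (𝓝[>] 0) atTop :=
  tendsto_rpow_neg_nhdsGT_zero (by rw [neg_div]; exact neg_lt_zero.2 (one_div_pos.2 hα))

lemma tendsto_tailRatio_sum (hX : ∀ t, Measurable (X t)) (hα : 0 < α)
    (hmax : IsMaxStableSeries P X) (hmarg : HasFrechetMargins P X α) {S : Finset ℤ}
    (hS : S.Nonempty) :
    Tendsto (tailRatio P X S) atTop
      (𝓝 (-∑ A ∈ S.powerset, (-1) ^ A.card * extremalCoeff P X A)) := by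
  obtain ⟨K, hK⟩ := exists_abs_tailRatio_sub_sum_le hX hα hmax hmarg hS
  have h1 : Tendsto (fun u : ℝ => K * u ^ (-α)) atTop (𝓝 0) := by
    simpa using (tendsto_rpow_neg_atTop hα).const_mul K
  rw [tendsto_iff_norm_sub_tendsto_zero]
  refine squeeze_zero' (Eventually.of_forall fun _ => norm_nonneg _) ?_ h1
  filter_upwards [eventually_ge_atTop 1] with u hu
  have hu0 : 0 < u := one_pos.trans_le hu
  have := hK (u ^ (-α)) (Real.rpow_pos_of_pos hu0 _)
    (Real.rpow_le_one_of_one_le_of_nonpos hu (neg_nonpos.2 hα.le))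
  rwa [rpow_rpow_level hα hu0] at this

/-- Inclusion–exclusion expresses tail dependence through extremal coefficients. -/
lemma tailCoeff_eq_sum (hX : ∀ t, Measurable (X t)) (hα : 0 < α)
    (hmax : IsMaxStableSeries P X) (hmarg : HasFrechetMargins P X α) {S : Finset ℤ}
    (hS : S.Nonempty) :
    tailCoeff P X S = -∑ A ∈ S.powerset, (-1) ^ A.card * extremalCoeff P X A :=
  (tendsto_tailRatio_sum hX hα hmax hmarg hS).limUnder_eq

theorem tendsto_tailRatio (hX : ∀ t, Measurable (X t)) (hα : 0 < α)
    (hmax : IsMaxStableSeries P X) (hmarg : HasFrechetMargins P X α) {S : Finset ℤ}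
    (hS : S.Nonempty) : Tendsto (tailRatio P X S) atTop (𝓝 (tailCoeff P X S)) := by
  rw [tailCoeff_eq_sum hX hα hmax hmarg hS]
  exact tendsto_tailRatio_sum hX hα hmax hmarg hS

/-- The bias of the joint exceedance ratio at the level `x ^ (-1/α)` is `O(x)`. -/
theorem exists_abs_tailRatio_sub_le (hX : ∀ t, Measurable (X t)) (hα : 0 < α)
    (hmax : IsMaxStableSeries P X) (hmarg : HasFrechetMargins P X α) {S : Finset ℤ}
    (hS : S.Nonempty) :
    ∃ K, ∀ x, 0 < x → x ≤ 1 →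
      |tailRatio P X S (x ^ (-1 / α)) - tailCoeff P X S| ≤ K * x := by
  rw [tailCoeff_eq_sum hX hα hmax hmarg hS]
  exact exists_abs_tailRatio_sub_sum_le hX hα hmax hmarg hS

/-- The joint exceedance probability at the level `x ^ (-1/α)` is asymptotic to
`tailCoeff P X S * x`. -/
lemma tendsto_jointExceed_div (hX : ∀ t, Measurable (X t)) (hα : 0 < α)
    (hmax : IsMaxStableSeries P X) (hmarg : HasFrechetMargins P X α) {S : Finset ℤ}
    (hS : S.Nonempty) :
    Tendsto (fun x : ℝ => P.real {ω | ∀ t ∈ S, x ^ (-1 / α) < X t ω} / x) (𝓝[>] 0)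
      (𝓝 (tailCoeff P X S)) := by
  have h1 := (tendsto_tailRatio hX hα hmax hmarg hS).comp (tendsto_level_atTop hα)
  have h2 : Tendsto (fun x : ℝ => (1 - Real.exp (-x)) / x) (𝓝[>] 0) (𝓝 1) := by
    have h3 : Tendsto (fun x : ℝ => 1 - x / 2) (𝓝[>] 0) (𝓝 1) := by
      have : Tendsto (fun x : ℝ => 1 - x / 2) (𝓝 0) (𝓝 (1 - 0 / 2)) :=
        (continuous_const.sub (continuous_id.div_const 2)).tendsto 0
      simpa using this.mono_left nhdsWithin_le_nhds
    refine tendsto_of_tendsto_of_tendsto_of_le_of_le' h3 tendsto_const_nhds ?_ ?_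
    · filter_upwards [self_mem_nhdsWithin] with x (hx : 0 < x)
      have := (abs_le.1 (abs_exp_neg_sub_le hx.le)).2
      rw [le_div_iff₀ hx]
      nlinarith
    · filter_upwards [self_mem_nhdsWithin] with x (hx : 0 < x)
      rw [div_le_one hx]
      exact one_sub_exp_le
  have h3 := h1.mul h2
  rw [mul_one] at h3
  refine h3.congr' ?_
  filter_upwards [self_mem_nhdsWithin] with x (hx : 0 < x)
  have hp : 0 < 1 - Real.exp (-x) := by simp [hx]
  simp only [Function.comp, tailRatio]
  rw [exceedProb_level hX hα hmarg hx]
  field_simp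

lemma tailCoeff_nonneg (hX : ∀ t, Measurable (X t)) (hα : 0 < α)
    (hmax : IsMaxStableSeries P X) (hmarg : HasFrechetMargins P X α) {S : Finset ℤ}
    (hS : S.Nonempty) : 0 ≤ tailCoeff P X S :=
  ge_of_tendsto' (tendsto_tailRatio hX hα hmax hmarg hS) fun _ =>
    div_nonneg measureReal_nonneg measureReal_nonneg

lemma tailCoeff_anti (hX : ∀ t, Measurable (X t)) (hα : 0 < α)
    (hmax : IsMaxStableSeries P X) (hmarg : HasFrechetMargins P X α) {S S' : Finset ℤ}
    (hS : S.Nonempty) (h : S ⊆ S') : tailCoeff P X S' ≤ tailCoeff P X S :=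
  le_of_tendsto_of_tendsto' (tendsto_tailRatio hX hα hmax hmarg (hS.mono h))
    (tendsto_tailRatio hX hα hmax hmarg hS) fun _ =>
    div_le_div_of_nonneg_right (measureReal_mono fun _ hω t ht => hω t (h ht)) measureReal_nonneg

lemma tailCoeff_pair (hX : ∀ t, Measurable (X t)) (hα : 0 < α)
    (hmax : IsMaxStableSeries P X) (hmarg : HasFrechetMargins P X α) {s t : ℤ} (hst : s ≠ t) :
    tailCoeff P X {s, t} = 2 - extremalCoeff P X {s, t} := by
  rw [tailCoeff_eq_sum hX hα hmax hmarg (Finset.insert_nonempty _ _),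
    Finset.sum_powerset_insert (by simpa using hst), ← insert_empty_eq t,
    Finset.sum_powerset_insert (Finset.notMem_empty t),
    Finset.sum_powerset_insert (Finset.notMem_empty t)]
  simp [extremalCoeff_empty, extremalCoeff_singleton hmarg, hst]
  ring

/-- Summability over positive lags of `2 - θ_h` gives summability over all lags of the pairwise tail
dependence coefficients. -/
lemma summable_tailCoeff_pair (hX : ∀ t, Measurable (X t)) (hα : 0 < α)
    (hstat : IsStationarySeries P X)
    (hmax : IsMaxStableSeries P X) (hmarg : HasFrechetMargins P X α)
    (hsum : Summable (fun t : ℕ => 2 - extremalCoeff P X {0, (t : ℤ) + 1})) :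
    Summable (fun h : ℤ => tailCoeff P X {0, h}) := by
  have hnat : Summable (fun n : ℕ => tailCoeff P X {0, (n : ℤ)}) := by
    rw [← summable_nat_add_iff 1]
    refine hsum.congr fun t => ?_
    push_cast
    rw [tailCoeff_pair hX hα hmax hmarg (by positivity)]
  exact Summable.of_nat_of_neg hnat (by simpa only [tailCoeff_pair_neg hstat] using hnat)

end TailCoeff

/-! ### Covariances in union-convolution semigroups of random sets -/

section UnionSemigroup

/-- Mean of `F` under the weights `w` on the subsets of the finite window `W`. -/
noncomputable def setMean (W : Finset ℤ) (w : Finset ℤ → ℝ) (F : Finset ℤ → ℂ) : ℂ :=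
  ∑ A ∈ W.powerset, (w A : ℂ) * F A

/-- Covariance (without conjugation) of two functions of a random subset of `W`. -/
noncomputable def setCov (W : Finset ℤ) (w : Finset ℤ → ℝ) (F G : Finset ℤ → ℂ) : ℂ :=
  setMean W w (fun A => F A * G A) - setMean W w F * setMean W w G

/-- Probability that the random subset of `W` with weights `w` contains both `i` and `j`. -/
noncomputable def pairMass (W : Finset ℤ) (w : Finset ℤ → ℝ) (i j : ℤ) : ℝ :=
  ∑ A ∈ W.powerset, w A * ((if i ∈ A then 1 else 0) * (if j ∈ A then 1 else 0))

/-- Number of indices `a ∈ I` whose site `pt a` lies in `A`. -/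
noncomputable def hitCount {ι : Type*} (I : Finset ι) (pt : ι → ℤ) (A : Finset ℤ) : ℝ :=
  ∑ a ∈ I, if pt a ∈ A then 1 else 0

/-- Enlarging the set `A` by `C` changes `F` by at most `c` for every hit of `C` by the sites
`pt a`, `a ∈ I`. -/
def HitLipschitz {ι : Type*} (c : ℝ) (I : Finset ι) (pt : ι → ℤ) (F : Finset ℤ → ℂ) : Prop :=
  ∀ A C, ‖F (A ∪ C) - F A‖ ≤ c * hitCount I pt C

/-- The weights `w x`, `x > 0`, are laws of random subsets of `W` such that the union of independent
sets with parameters `x` and `y` has parameter `x + y`. The hitting probabilities of points are at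
most `x`, those of pairs are asymptotic to `χ i j * x` for small `x`. -/
structure IsUnionSemigroup (W : Finset ℤ) (w : ℝ → Finset ℤ → ℝ) (χ : ℤ → ℤ → ℝ) : Prop where
  nonneg : ∀ x A, 0 ≤ w x A
  sum_eq_one : ∀ x, ∑ A ∈ W.powerset, w x A = 1
  mean_union : ∀ x y, 0 < x → 0 < y → ∀ F, setMean W (w (x + y)) F =
    setMean W (w x) fun A => setMean W (w y) fun B => F (A ∪ B)
  point_le : ∀ x, 0 < x → ∀ i ∈ W, pairMass W (w x) i i ≤ x
  pair_tendsto : ∀ i ∈ W, ∀ j ∈ W,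
    Tendsto (fun x => pairMass W (w x) i j / x) (𝓝[>] 0) (𝓝 (χ i j))

variable {W : Finset ℤ} {ι κ : Type*} {c d : ℝ} {I : Finset ι} {J : Finset κ} {p : ι → ℤ}
  {q : κ → ℤ} {F G : Finset ℤ → ℂ}

lemma pairMass_nonneg {w : Finset ℤ → ℝ} (hw : ∀ A, 0 ≤ w A) (i j : ℤ) :
    0 ≤ pairMass W w i j :=
  Finset.sum_nonneg fun A _ => mul_nonneg (hw A) (by split_ifs <;> norm_num)

lemma norm_setMean_le {w : Finset ℤ → ℝ} (hw : ∀ A, 0 ≤ w A) {f : Finset ℤ → ℝ}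
    (hf : ∀ A, ‖F A‖ ≤ f A) : ‖setMean W w F‖ ≤ ∑ A ∈ W.powerset, w A * f A := by
  refine (norm_sum_le _ _).trans (Finset.sum_le_sum fun A _ => ?_)
  rw [norm_mul, Complex.norm_of_nonneg (hw A)]
  exact mul_le_mul_of_nonneg_left (hf A) (hw A)

lemma setMean_add (w : Finset ℤ → ℝ) (F G : Finset ℤ → ℂ) :
    setMean W w (fun A => F A + G A) = setMean W w F + setMean W w G := by
  simp [setMean, mul_add, Finset.sum_add_distrib]

lemma setMean_sub (w : Finset ℤ → ℝ) (F G : Finset ℤ → ℂ) :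
    setMean W w (fun A => F A - G A) = setMean W w F - setMean W w G := by
  simp [setMean, mul_sub, Finset.sum_sub_distrib]

lemma setMean_const_mul (w : Finset ℤ → ℝ) (z : ℂ) (F : Finset ℤ → ℂ) :
    setMean W w (fun A => z * F A) = z * setMean W w F := by
  simp only [setMean, Finset.mul_sum]
  exact Finset.sum_congr rfl fun _ _ => by ring

lemma setMean_const {w : Finset ℤ → ℝ} (h1 : ∑ A ∈ W.powerset, w A = 1) (z : ℂ) :
    setMean W w (fun _ => z) = z := by
  rw [setMean, ← Finset.sum_mul]
  norm_cast
  rw [h1]; simp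

lemma sum_mul_hitCount (w : Finset ℤ → ℝ) (I : Finset ι) (p : ι → ℤ) :
    ∑ A ∈ W.powerset, w A * hitCount I p A = ∑ a ∈ I, pairMass W w (p a) (p a) := by
  simp only [hitCount, pairMass, Finset.mul_sum]
  rw [Finset.sum_comm]
  refine Finset.sum_congr rfl fun a _ => Finset.sum_congr rfl fun A _ => ?_
  split_ifs <;> simp

/-- One-step covariance bound, useful when the random set is rarely nonempty. -/
lemma norm_setCov_le {w : Finset ℤ → ℝ} (hw : ∀ A, 0 ≤ w A) (h1 : ∑ A ∈ W.powerset, w A = 1)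
    (hF : HitLipschitz c I p F) (hG : HitLipschitz d J q G) :
    ‖setCov W w F G‖ ≤ c * d * ∑ a ∈ I, ∑ b ∈ J,
      (pairMass W w (p a) (q b) +
        pairMass W w (p a) (p a) * pairMass W w (q b) (q b)) := by
  -- covariances do not change when constants are subtracted
  set f : Finset ℤ → ℂ := fun A => F A - F ∅ with hf
  set g : Finset ℤ → ℂ := fun A => G A - G ∅ with hg
  have hfb : ∀ A, ‖f A‖ ≤ c * hitCount I p A := fun A => by simpa using hF ∅ A
  have hgb : ∀ A, ‖g A‖ ≤ d * hitCount J q A := fun A => by simpa using hG ∅ A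
  have hcov : setCov W w F G = setMean W w (fun A => f A * g A) -
      setMean W w f * setMean W w g := by
    have hF' : F = fun A => F ∅ + f A := by ext; simp [hf]
    have hG' : G = fun A => G ∅ + g A := by ext; simp [hg]
    have hfg : (fun A => F A * G A) =
        fun A => (F ∅ * G ∅ + F ∅ * g A) + (G ∅ * f A + f A * g A) := by
      ext A
      simp only [hf, hg]
      ring
    rw [setCov, hfg, setMean_add, setMean_add, setMean_add, setMean_const_mul w (F ∅) g,
      setMean_const_mul w (G ∅) f, setMean_const h1]
    have e1 : setMean W w F = F ∅ + setMean W w f := by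
      conv_lhs => rw [hF']
      rw [setMean_add, setMean_const h1]
    have e2 : setMean W w G = G ∅ + setMean W w g := by
      conv_lhs => rw [hG']
      rw [setMean_add, setMean_const h1]
    rw [e1, e2]
    ring
  have e1 : ‖setMean W w (fun A => f A * g A)‖ ≤
      c * d * ∑ a ∈ I, ∑ b ∈ J, pairMass W w (p a) (q b) := by
    refine (norm_setMean_le hw (f := fun A => (c * hitCount I p A) * (d * hitCount J q A))
      fun A => ?_).trans (le_of_eq ?_)
    · rw [norm_mul]
      exact mul_le_mul (hfb A) (hgb A) (norm_nonneg _) ((norm_nonneg _).trans (hfb A))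
    · calc ∑ A ∈ W.powerset, w A * ((c * hitCount I p A) * (d * hitCount J q A))
          = ∑ A ∈ W.powerset, c * d * (w A * (hitCount I p A * hitCount J q A)) :=
            Finset.sum_congr rfl fun A _ => by ring
        _ = c * d * ∑ A ∈ W.powerset, ∑ a ∈ I, ∑ b ∈ J,
              w A * ((if p a ∈ A then 1 else 0) * (if q b ∈ A then 1 else 0)) := by
            rw [← Finset.mul_sum]
            congr 1
            refine Finset.sum_congr rfl fun A _ => ?_
            rw [hitCount, hitCount, Finset.sum_mul_sum, Finset.mul_sum]
            exact Finset.sum_congr rfl fun a _ => Finset.mul_sum _ _ _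
        _ = c * d * ∑ a ∈ I, ∑ b ∈ J, pairMass W w (p a) (q b) := by
            rw [Finset.sum_comm]
            congr 1
            exact Finset.sum_congr rfl fun a _ => Finset.sum_comm
  have e2 : ‖setMean W w f‖ ≤ c * ∑ a ∈ I, pairMass W w (p a) (p a) := by
    refine (norm_setMean_le hw hfb).trans (le_of_eq ?_)
    rw [← sum_mul_hitCount w I p, Finset.mul_sum]
    exact Finset.sum_congr rfl fun A _ => by ring
  have e3 : ‖setMean W w g‖ ≤ d * ∑ b ∈ J, pairMass W w (q b) (q b) := by
    refine (norm_setMean_le hw hgb).trans (le_of_eq ?_)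
    rw [← sum_mul_hitCount w J q, Finset.mul_sum]
    exact Finset.sum_congr rfl fun A _ => by ring
  rw [hcov]
  refine (norm_sub_le _ _).trans ?_
  rw [norm_mul]
  refine (add_le_add e1 (mul_le_mul e2 e3 (norm_nonneg _) ((norm_nonneg _).trans e2))).trans
    (le_of_eq ?_)
  simp only [Finset.sum_add_distrib]
  rw [← Finset.sum_mul_sum]
  ring

lemma HitLipschitz.comp_union (hF : HitLipschitz c I p F) (A : Finset ℤ) :
    HitLipschitz c I p fun B => F (A ∪ B) := fun B C => by
  simpa only [Finset.union_assoc] using hF (A ∪ B) C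

/-- Averaging over an independent part of the union preserves the Lipschitz bound. -/
lemma HitLipschitz.setMean_union {w : Finset ℤ → ℝ} (hw : ∀ A, 0 ≤ w A)
    (h1 : ∑ A ∈ W.powerset, w A = 1) (hF : HitLipschitz c I p F) :
    HitLipschitz c I p fun A => setMean W w fun B => F (A ∪ B) := fun A C => by
  rw [← setMean_sub]
  refine (norm_setMean_le hw (f := fun _ => c * hitCount I p C) fun B => ?_).trans (le_of_eq ?_)
  · rw [Finset.union_right_comm]
    exact hF _ _
  · rw [← Finset.sum_mul, h1, one_mul]

namespace IsUnionSemigroup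

variable {w : ℝ → Finset ℤ → ℝ} {χ : ℤ → ℤ → ℝ}

/-- The law of total covariance along the semigroup. -/
lemma setCov_add (h : IsUnionSemigroup W w χ) {x y : ℝ} (hx : 0 < x) (hy : 0 < y)
    (F G : Finset ℤ → ℂ) :
    setCov W (w (x + y)) F G =
      setMean W (w x) (fun A => setCov W (w y) (fun B => F (A ∪ B)) fun B => G (A ∪ B)) +
      setCov W (w x) (fun A => setMean W (w y) fun B => F (A ∪ B))
        (fun A => setMean W (w y) fun B => G (A ∪ B)) := by
  simp only [setCov]
  rw [h.mean_union x y hx hy, h.mean_union x y hx hy, h.mean_union x y hx hy, setMean_sub]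
  ring

/-- Iterating the law of total covariance over `k + 1` pieces of parameter `y`. -/
lemma norm_setCov_nsmul_le (h : IsUnionSemigroup W w χ) {y : ℝ} (hy : 0 < y)
    (hI : ∀ a ∈ I, p a ∈ W) (hJ : ∀ b ∈ J, q b ∈ W) (hcd : 0 ≤ c * d) (k : ℕ) :
    ∀ F G, HitLipschitz c I p F → HitLipschitz d J q G →
    ‖setCov W (w ((k + 1 : ℕ) * y)) F G‖ ≤ (k + 1 : ℕ) * (c * d * ∑ a ∈ I, ∑ b ∈ J,
      (pairMass W (w y) (p a) (q b) + y ^ 2)) := by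
  set δ := c * d * ∑ a ∈ I, ∑ b ∈ J, (pairMass W (w y) (p a) (q b) + y ^ 2) with hδ
  have hone : ∀ F G, HitLipschitz c I p F → HitLipschitz d J q G →
      ‖setCov W (w y) F G‖ ≤ δ := fun F G hF hG => by
    refine (norm_setCov_le (h.nonneg y) (h.sum_eq_one y) hF hG).trans
      (mul_le_mul_of_nonneg_left ?_ hcd)
    refine Finset.sum_le_sum fun a ha => Finset.sum_le_sum fun b hb => ?_
    rw [sq]
    gcongr
    · exact pairMass_nonneg (h.nonneg y) _ _
    · exact h.point_le y hy _ (hI a ha)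
    · exact h.point_le y hy _ (hJ b hb)
  induction k with
  | zero =>
    intro F G hF hG
    simpa using hone F G hF hG
  | succ k ih =>
    intro F G hF hG
    have hk : (0 : ℝ) < (k + 1 : ℕ) * y := by positivity
    have e : ((k + 1 + 1 : ℕ) : ℝ) * y = (k + 1 : ℕ) * y + y := by push_cast; ring
    rw [e, h.setCov_add hk hy]
    refine (norm_add_le _ _).trans ?_
    have e1 : ‖setMean W (w ((k + 1 : ℕ) * y))
        (fun A => setCov W (w y) (fun B => F (A ∪ B)) fun B => G (A ∪ B))‖ ≤ δ := by
      refine (norm_setMean_le (h.nonneg _) (f := fun _ => δ) fun A =>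
        hone _ _ (hF.comp_union A) (hG.comp_union A)).trans (le_of_eq ?_)
      rw [← Finset.sum_mul, h.sum_eq_one, one_mul]
    have e2 := ih _ _ (hF.setMean_union (h.nonneg y) (h.sum_eq_one y))
      (hG.setMean_union (h.nonneg y) (h.sum_eq_one y))
    refine (add_le_add e1 e2).trans (le_of_eq ?_)
    push_cast
    ring

/-- Covariance inequality: cutting the parameter `x` into many small pieces, only the simultaneous
hits by one piece contribute to the covariance. -/
theorem norm_setCov_le (h : IsUnionSemigroup W w χ) {x : ℝ} (hx : 0 < x)
    (hI : ∀ a ∈ I, p a ∈ W) (hJ : ∀ b ∈ J, q b ∈ W) (hcd : 0 ≤ c * d)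
    (hF : HitLipschitz c I p F) (hG : HitLipschitz d J q G) :
    ‖setCov W (w x) F G‖ ≤ c * d * (x * ∑ a ∈ I, ∑ b ∈ J, χ (p a) (q b)) := by
  have hy0 : Tendsto (fun k : ℕ => x / (k + 1 : ℕ)) atTop (𝓝[>] 0) := by
    refine tendsto_nhdsWithin_iff.2 ⟨?_, Eventually.of_forall fun k => by
      simp only [Set.mem_Ioi]; positivity⟩
    exact (tendsto_const_div_atTop_nhds_zero_nat x).comp (tendsto_add_atTop_nat 1)
  have hbound : ∀ k : ℕ, ‖setCov W (w x) F G‖ ≤ c * d * (x * ∑ a ∈ I, ∑ b ∈ J,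
      (pairMass W (w (x / (k + 1 : ℕ))) (p a) (q b) / (x / (k + 1 : ℕ)) +
        x / (k + 1 : ℕ))) := by
    intro k
    have hk : (0 : ℝ) < (k + 1 : ℕ) := by positivity
    have h1 := h.norm_setCov_nsmul_le (y := x / (k + 1 : ℕ)) (by positivity) hI hJ hcd k F G hF hG
    rw [mul_div_cancel₀ x hk.ne'] at h1
    refine h1.trans (le_of_eq ?_)
    rw [mul_left_comm]
    congr 1
    rw [Finset.mul_sum, Finset.mul_sum]
    refine Finset.sum_congr rfl fun a _ => ?_
    rw [Finset.mul_sum, Finset.mul_sum]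
    refine Finset.sum_congr rfl fun b _ => ?_
    field_simp
  refine ge_of_tendsto' (x := atTop) ?_ hbound
  refine Tendsto.const_mul _ (Tendsto.const_mul _ (tendsto_finsetSum _ fun a ha =>
    tendsto_finsetSum _ fun b hb => ?_))
  have := ((h.pair_tendsto _ (hI a ha) _ (hJ b hb)).comp hy0).add
    (tendsto_nhdsWithin_iff.1 hy0).1
  rwa [add_zero] at this

end IsUnionSemigroup

end UnionSemigroup

/-! ### The exceedance sets of a max-stable series -/

section ExceedSet

/-- The random set of times in `W` at which `X` exceeds the level `u`. -/
noncomputable def exceedSet {Ω : Type*} (X : ℤ → Ω → ℝ) (u : ℝ) (W : Finset ℤ) (ω : Ω) :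
    Finset ℤ :=
  W.filter fun t => u < X t ω

/-- The probability mass function of the exceedance set at the level `x ^ (-1/α)`. -/
noncomputable def exceedWeight {Ω : Type*} [MeasurableSpace Ω] (P : Measure Ω) (X : ℤ → Ω → ℝ)
    (α : ℝ) (W : Finset ℤ) (x : ℝ) (A : Finset ℤ) : ℝ :=
  P.real {ω | exceedSet X (x ^ (-1 / α)) W ω = A}

variable {Ω : Type*} {X : ℤ → Ω → ℝ}

lemma mem_exceedSet {u : ℝ} {W : Finset ℤ} {ω : Ω} {t : ℤ} :
    t ∈ exceedSet X u W ω ↔ t ∈ W ∧ u < X t ω := Finset.mem_filter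

lemma exceedSet_subset {u : ℝ} {W : Finset ℤ} {ω : Ω} : exceedSet X u W ω ⊆ W :=
  Finset.filter_subset _ _

variable [MeasurableSpace Ω] {P : Measure Ω} [IsProbabilityMeasure P] {α : ℝ}

lemma measurableSet_exceedSet_eq (hX : ∀ t, Measurable (X t)) (u : ℝ) (W A : Finset ℤ) :
    MeasurableSet {ω | exceedSet X u W ω = A} := by
  have : {ω | exceedSet X u W ω = A} = ⋂ t : ℤ, {ω | (t ∈ W ∧ u < X t ω) ↔ t ∈ A} := by
    ext ω
    simp only [Set.mem_ofPred_eq, Set.mem_iInter, Finset.ext_iff, mem_exceedSet]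
  rw [this]
  refine MeasurableSet.iInter fun t => ?_
  have hm : MeasurableSet {ω | u < X t ω} := measurableSet_lt measurable_const (hX t)
  exact ((MeasurableSet.const (t ∈ W)).inter hm).iff (MeasurableSet.const (t ∈ A))

lemma integral_comp_exceedSet {E : Type*} [NormedAddCommGroup E] [NormedSpace ℝ E]
    [CompleteSpace E] (hX : ∀ t, Measurable (X t)) (u : ℝ) (W : Finset ℤ) (F : Finset ℤ → E) :
    ∫ ω, F (exceedSet X u W ω) ∂P =
      ∑ A ∈ W.powerset, P.real {ω | exceedSet X u W ω = A} • F A := by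
  have hpt : ∀ ω, F (exceedSet X u W ω) = ∑ A ∈ W.powerset,
      Set.indicator {ω | exceedSet X u W ω = A} (fun _ => F A) ω := by
    intro ω
    rw [Finset.sum_eq_single_of_mem (exceedSet X u W ω) (Finset.mem_powerset.2 exceedSet_subset)]
    · simp
    · intro A _ hA
      simp [hA.symm]
  simp_rw [hpt]
  rw [integral_finsetSum]
  · exact Finset.sum_congr rfl fun A _ => integral_indicator_const _
      (measurableSet_exceedSet_eq hX u W A)
  · exact fun A _ => (integrable_const _).indicator (measurableSet_exceedSet_eq hX u W A)

lemma setMean_exceedWeight (hX : ∀ t, Measurable (X t)) (W : Finset ℤ) (x : ℝ)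
    (F : Finset ℤ → ℂ) :
    setMean W (exceedWeight P X α W x) F = ∫ ω, F (exceedSet X (x ^ (-1 / α)) W ω) ∂P := by
  rw [integral_comp_exceedSet hX]
  simp [setMean, exceedWeight]

lemma pairMass_exceedWeight (hX : ∀ t, Measurable (X t)) {W : Finset ℤ} (x : ℝ) {i j : ℤ}
    (hi : i ∈ W) (hj : j ∈ W) :
    pairMass W (exceedWeight P X α W x) i j =
      P.real {ω | ∀ t ∈ ({i, j} : Finset ℤ), x ^ (-1 / α) < X t ω} := by
  have h := integral_comp_exceedSet (P := P) hX (x ^ (-1 / α)) W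
    (fun A => (if i ∈ A then (1 : ℝ) else 0) * (if j ∈ A then 1 else 0))
  rw [← integral_indicator_one (measurableSet_forall_gt hX _ _)]
  refine Eq.trans h.symm (integral_congr_ae (ae_of_all _ fun ω => ?_))
  simp only [mem_exceedSet, hi, hj, true_and, Set.indicator_apply, Set.mem_ofPred_eq,
    Finset.mem_insert, Finset.mem_singleton, forall_eq_or_imp, forall_eq, Pi.one_apply]
  split_ifs <;> simp_all

/-- A function on the subsets of `W` is determined by its sums over all power sets. -/
lemma eq_of_sum_powerset_eq {W : Finset ℤ} {v w : Finset ℤ → ℝ}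
    (h : ∀ B ⊆ W, ∑ A ∈ B.powerset, v A = ∑ A ∈ B.powerset, w A) :
    ∀ B ⊆ W, v B = w B := by
  intro B
  induction B using Finset.strongInduction with
  | H B ih =>
    intro hB
    have h1 := h B hB
    have hmem : B ∈ B.powerset := Finset.mem_powerset_self B
    rw [← Finset.add_sum_erase _ _ hmem, ← Finset.add_sum_erase _ w hmem] at h1
    have h2 : ∑ A ∈ B.powerset.erase B, v A = ∑ A ∈ B.powerset.erase B, w A := by
      refine Finset.sum_congr rfl fun A hA => ?_
      rw [Finset.mem_erase, Finset.mem_powerset] at hA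
      exact ih A (hA.2.ssubset_of_ne hA.1) (hA.2.trans hB)
    linarith

lemma sum_exceedWeight_powerset (hX : ∀ t, Measurable (X t)) (hα : 0 < α)
    (hmax : IsMaxStableSeries P X) (hmarg : HasFrechetMargins P X α) (W B : Finset ℤ)
    {x : ℝ} (hx : 0 < x) :
    ∑ A ∈ B.powerset, exceedWeight P X α W x A = Real.exp (-x * extremalCoeff P X (W \ B)) := by
  rw [← measureReal_forall_le_level hX hα hmax hmarg _ hx]
  simp only [exceedWeight]
  rw [← measureReal_biUnion_finset]
  · congr 1
    ext ω
    simp only [Set.mem_iUnion, Set.mem_ofPred_eq, Finset.mem_powerset, exists_prop,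
      exists_eq_right', Finset.mem_sdiff]
    constructor
    · intro h t ht
      by_contra hlt
      exact ht.2 (h (mem_exceedSet.2 ⟨ht.1, not_le.1 hlt⟩))
    · intro h t ht
      rw [mem_exceedSet] at ht
      by_contra htB
      exact absurd (h t ⟨ht.1, htB⟩) (not_le.2 ht.2)
  · intro A _ A' _ hne
    rw [Function.onFun, Set.disjoint_left]
    intro ω h h'
    exact hne (Eq.trans (Eq.symm h) h')
  · exact fun A _ => measurableSet_exceedSet_eq hX _ _ _

/-- Max-stability: the exceedance set for the parameter `x + y` is distributed as the union of
independent exceedance sets for `x` and `y`, since the probabilities of containment in a given set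
are exponential in the parameter. -/
lemma setMean_exceedWeight_add (hX : ∀ t, Measurable (X t)) (hα : 0 < α)
    (hmax : IsMaxStableSeries P X) (hmarg : HasFrechetMargins P X α) (W : Finset ℤ)
    {x y : ℝ} (hx : 0 < x) (hy : 0 < y) (F : Finset ℤ → ℂ) :
    setMean W (exceedWeight P X α W (x + y)) F =
      setMean W (exceedWeight P X α W x) fun A =>
        setMean W (exceedWeight P X α W y) fun B => F (A ∪ B) := by
  set v := exceedWeight P X α W x
  set w := exceedWeight P X α W y
  set ν : Finset ℤ → ℝ := fun C => ∑ A ∈ W.powerset, ∑ B ∈ W.powerset,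
    if A ∪ B = C then v A * w B else 0 with hν
  have hsub : ∀ {D : Finset ℤ} (f : Finset ℤ → ℝ), D ⊆ W →
      ∑ A ∈ W.powerset, (if A ⊆ D then f A else 0) = ∑ A ∈ D.powerset, f A := by
    intro D f hD
    rw [← Finset.sum_filter]
    refine Finset.sum_congr ?_ fun _ _ => rfl
    ext A
    simp only [Finset.mem_filter, Finset.mem_powerset]
    exact ⟨fun h => h.2, fun h => ⟨h.trans hD, h⟩⟩
  have hνw : ∀ C ⊆ W, ν C = exceedWeight P X α W (x + y) C := by
    refine eq_of_sum_powerset_eq fun D hD => ?_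
    rw [sum_exceedWeight_powerset hX hα hmax hmarg W D (add_pos hx hy)]
    calc ∑ C ∈ D.powerset, ν C
        = ∑ A ∈ W.powerset, ∑ B ∈ W.powerset, if A ∪ B ⊆ D then v A * w B else 0 := by
          rw [Finset.sum_comm]
          refine Finset.sum_congr rfl fun A _ => ?_
          rw [Finset.sum_comm]
          refine Finset.sum_congr rfl fun B _ => ?_
          rw [Finset.sum_ite_eq]
          simp
      _ = ∑ A ∈ W.powerset, ∑ B ∈ W.powerset,
            (if A ⊆ D then v A else 0) * (if B ⊆ D then w B else 0) := by
          refine Finset.sum_congr rfl fun A _ => Finset.sum_congr rfl fun B _ => ?_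
          by_cases hA : A ⊆ D <;> by_cases hB : B ⊆ D <;> simp [Finset.union_subset_iff, hA, hB]
      _ = Real.exp (-(x + y) * extremalCoeff P X (W \ D)) := by
          rw [← Finset.sum_mul_sum, hsub v hD, hsub w hD,
            sum_exceedWeight_powerset hX hα hmax hmarg W D hx,
            sum_exceedWeight_powerset hX hα hmax hmarg W D hy, ← Real.exp_add]
          congr 1
          ring
  calc setMean W (exceedWeight P X α W (x + y)) F
      = ∑ C ∈ W.powerset, (ν C : ℂ) * F C :=
        Finset.sum_congr rfl fun C hC => by rw [hνw C (Finset.mem_powerset.1 hC)]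
    _ = ∑ A ∈ W.powerset, ∑ B ∈ W.powerset, ∑ C ∈ W.powerset,
          if A ∪ B = C then (v A * w B : ℂ) * F C else 0 := by
        simp only [hν, Complex.ofReal_sum, Finset.sum_mul]
        rw [Finset.sum_comm]
        refine Finset.sum_congr rfl fun A _ => ?_
        rw [Finset.sum_comm]
        refine Finset.sum_congr rfl fun B _ => Finset.sum_congr rfl fun C _ => ?_
        split_ifs <;> simp
    _ = _ := by
        simp only [setMean, Finset.mul_sum]
        refine Finset.sum_congr rfl fun A hA => Finset.sum_congr rfl fun B hB => ?_
        rw [Finset.sum_ite_eq, if_pos]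
        · ring
        · exact Finset.mem_powerset.2
            (Finset.union_subset (Finset.mem_powerset.1 hA) (Finset.mem_powerset.1 hB))

theorem isUnionSemigroup_exceedWeight (hX : ∀ t, Measurable (X t)) (hα : 0 < α)
    (hmax : IsMaxStableSeries P X) (hmarg : HasFrechetMargins P X α) (W : Finset ℤ) :
    IsUnionSemigroup W (exceedWeight P X α W) fun i j => tailCoeff P X {i, j} where
  nonneg _ _ := measureReal_nonneg
  sum_eq_one x := by
    have h := integral_comp_exceedSet (P := P) hX (x ^ (-1 / α)) W (fun _ => (1 : ℝ))
    simpa [exceedWeight] using h.symm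
  mean_union x y hx hy F := setMean_exceedWeight_add hX hα hmax hmarg W hx hy F
  point_le x hx i hi := by
    rw [pairMass_exceedWeight hX x hi hi]
    have h : {ω | ∀ t ∈ ({i, i} : Finset ℤ), x ^ (-1 / α) < X t ω} =
        {ω | X i ω ≤ x ^ (-1 / α)}ᶜ := by ext; simp
    rw [h, probReal_compl_eq_one_sub (measurableSet_le (hX i) measurable_const),
      hmarg i _ (Real.rpow_pos_of_pos hx _), rpow_level_rpow hα hx]
    exact one_sub_exp_le
  pair_tendsto i hi j hj := by
    simp_rw [pairMass_exceedWeight hX _ hi hj]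
    exact tendsto_jointExceed_div hX hα hmax hmarg (Finset.insert_nonempty _ _)

/-- Covariance inequality for functions of the exceedances. -/
theorem norm_integral_mul_sub_le (hX : ∀ t, Measurable (X t)) (hα : 0 < α)
    (hmax : IsMaxStableSeries P X) (hmarg : HasFrechetMargins P X α) (W : Finset ℤ) {x : ℝ}
    (hx : 0 < x) {ι κ : Type*} {c d : ℝ} {I : Finset ι} {J : Finset κ} {p : ι → ℤ}
    {q : κ → ℤ} {F G : Finset ℤ → ℂ} (hI : ∀ a ∈ I, p a ∈ W) (hJ : ∀ b ∈ J, q b ∈ W)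
    (hcd : 0 ≤ c * d) (hF : HitLipschitz c I p F) (hG : HitLipschitz d J q G) :
    ‖∫ ω, F (exceedSet X (x ^ (-1 / α)) W ω) * G (exceedSet X (x ^ (-1 / α)) W ω) ∂P -
      (∫ ω, F (exceedSet X (x ^ (-1 / α)) W ω) ∂P) *
        ∫ ω, G (exceedSet X (x ^ (-1 / α)) W ω) ∂P‖ ≤
      c * d * (x * ∑ a ∈ I, ∑ b ∈ J, tailCoeff P X {p a, q b}) := by
  have h := (isUnionSemigroup_exceedWeight hX hα hmax hmarg W).norm_setCov_le hx hI hJ hcd hF hG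
  simpa only [setCov, setMean_exceedWeight hX] using h

end ExceedSet

/-! ### Limits of characteristic functions from approximate block factorization -/

section Blocks

lemma norm_pow_sub_pow_le_of_norm_le_one {a b : ℂ} (ha : ‖a‖ ≤ 1) (hb : ‖b‖ ≤ 1) (k : ℕ) :
    ‖a ^ k - b ^ k‖ ≤ k * ‖a - b‖ := by
  induction k with
  | zero => simp
  | succ k ih =>
    have : a ^ (k + 1) - b ^ (k + 1) = (a ^ k - b ^ k) * a + b ^ k * (a - b) := by ring
    rw [this]
    refine (norm_add_le _ _).trans ?_
    rw [norm_mul, norm_mul, norm_pow]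
    have h1 : ‖a ^ k - b ^ k‖ * ‖a‖ ≤ k * ‖a - b‖ :=
      (mul_le_of_le_one_right (norm_nonneg _) ha).trans ih
    have h2 : ‖b‖ ^ k * ‖a - b‖ ≤ ‖a - b‖ :=
      mul_le_of_le_one_left (norm_nonneg _) (pow_le_one₀ (norm_nonneg _) hb)
    push_cast
    linarith

/-- Splitting off `k` blocks of length `r` one after the other, each at cost `e`. -/
lemma norm_block_sub_pow_le {φ : ℕ → ℂ} {e : ℝ} {r : ℕ} (h1 : ∀ m, ‖φ m‖ ≤ 1)
    (hfac : ∀ l, ‖φ (r + l) - φ r * φ l‖ ≤ e) (k q : ℕ) :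
    ‖φ (r * k + q) - φ r ^ k * φ q‖ ≤ k * e := by
  induction k with
  | zero => simp
  | succ k ih =>
    have e1 : r * (k + 1) + q = r + (r * k + q) := by ring
    have e2 : φ (r * (k + 1) + q) - φ r ^ (k + 1) * φ q =
        (φ (r + (r * k + q)) - φ r * φ (r * k + q)) +
          φ r * (φ (r * k + q) - φ r ^ k * φ q) := by
      rw [e1]; ring
    rw [e2]
    refine (norm_add_le _ _).trans ?_
    rw [norm_mul]
    have h3 := mul_le_of_le_one_left (norm_nonneg (φ (r * k + q) - φ r ^ k * φ q)) (h1 r)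
    push_cast
    linarith [hfac (r * k + q)]

lemma tendsto_nat_mul_exp_sub_one (z : ℂ) :
    Tendsto (fun n : ℕ => (n : ℂ) * (Complex.exp (z / n) - 1)) atTop (𝓝 z) := by
  have h0 : Tendsto (fun n : ℕ => ‖z‖ ^ 2 / n) atTop (𝓝 0) :=
    tendsto_const_div_atTop_nhds_zero_nat _
  have h1 : Tendsto (fun n : ℕ => ‖z‖ / n) atTop (𝓝 0) :=
    tendsto_const_div_atTop_nhds_zero_nat _
  rw [tendsto_iff_norm_sub_tendsto_zero]
  refine squeeze_zero' (Eventually.of_forall fun _ => norm_nonneg _) ?_ h0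
  filter_upwards [h1.eventually_le_const one_pos, eventually_gt_atTop 0] with n hn hn0
  have hn1 : (0 : ℝ) < n := by exact_mod_cast hn0
  have hnc : (n : ℂ) ≠ 0 := by exact_mod_cast hn0.ne'
  have hz : ‖z / (n : ℂ)‖ = ‖z‖ / n := by rw [norm_div, Complex.norm_natCast]
  have e : (n : ℂ) * (Complex.exp (z / n) - 1) - z =
      n * (Complex.exp (z / n) - 1 - z / n) := by field_simp
  rw [e, norm_mul, Complex.norm_natCast]
  have h2 := Complex.norm_exp_sub_one_sub_id_le (x := z / n) (by rw [hz]; exact hn)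
  rw [hz] at h2
  calc (n : ℝ) * ‖Complex.exp (z / n) - 1 - z / n‖ ≤ n * (‖z‖ / n) ^ 2 := by gcongr
    _ = ‖z‖ ^ 2 / n := by field_simp

lemma tendsto_nat_div_div {r : ℕ} (hr : 0 < r) :
    Tendsto (fun n : ℕ => ((n / r : ℕ) : ℝ) / n) atTop (𝓝 (1 / r)) := by
  have h0 : Tendsto (fun n : ℕ => (1 : ℝ) / n) atTop (𝓝 0) :=
    tendsto_const_div_atTop_nhds_zero_nat _
  rw [tendsto_iff_norm_sub_tendsto_zero]
  refine squeeze_zero' (Eventually.of_forall fun _ => norm_nonneg _) ?_ h0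
  filter_upwards [eventually_gt_atTop 0] with n hn0
  have hn1 : (0 : ℝ) < n := by exact_mod_cast hn0
  have hr1 : (0 : ℝ) < r := by exact_mod_cast hr
  have hdm : (n : ℝ) = r * (n / r : ℕ) + (n % r : ℕ) := by exact_mod_cast (Nat.div_add_mod n r).symm
  have hmod : ((n % r : ℕ) : ℝ) ≤ r := by exact_mod_cast (Nat.mod_lt n hr).le
  have e : ((n / r : ℕ) : ℝ) / n - 1 / r = -((n % r : ℕ) / (r * n)) := by
    rw [div_sub_div _ _ hn1.ne' hr1.ne', mul_comm (n : ℝ) (r : ℝ), ← neg_div]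
    congr 1
    linarith
  rw [e, norm_neg, Real.norm_of_nonneg (by positivity), div_le_div_iff₀ (by positivity) hn1]
  nlinarith

/-- The characteristic functions `φ n n` of sums of length `n` converge if cutting off a block of
fixed length `r` costs at most `κ r / n` up to a constant, where `κ r = o(r)`, and the
characteristic functions of blocks of fixed length have a first-order expansion. -/
theorem tendsto_of_block_factorization {φ : ℕ → ℕ → ℂ} {κ z : ℕ → ℝ} {C z₀ : ℝ}
    (h1 : ∀ n m, ‖φ n m‖ ≤ 1)
    (hfac : ∀ᶠ n : ℕ in atTop, ∀ r l, ‖φ n (r + l) - φ n r * φ n l‖ ≤ C / n * κ r)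
    (hκ : Tendsto (fun r : ℕ => (r : ℝ)⁻¹ * κ r) atTop (𝓝 0))
    (hz : ∀ m, Tendsto (fun n : ℕ => (n : ℂ) * (φ n m - 1)) atTop (𝓝 (z m)))
    (hz_nonpos : ∀ m, z m ≤ 0)
    (hz₀ : Tendsto (fun m : ℕ => (m : ℝ)⁻¹ * z m) atTop (𝓝 z₀)) :
    Tendsto (fun n => φ n n) atTop (𝓝 (Complex.exp z₀)) := by
  have hlim1 : ∀ m, Tendsto (fun n => φ n m) atTop (𝓝 1) := by
    intro m
    have h := (tendsto_inv_atTop_nhds_zero_nat (𝕜 := ℂ)).mul (hz m)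
    rw [zero_mul] at h
    have h' : Tendsto (fun n => φ n m - 1) atTop (𝓝 0) := by
      refine h.congr' ?_
      filter_upwards [eventually_gt_atTop 0] with n hn
      rw [inv_mul_cancel_left₀ (by exact_mod_cast hn.ne')]
    simpa using h'.add_const 1
  -- for a fixed block length, powers of the block characteristic function converge
  have hpow : ∀ r, 0 < r → Tendsto (fun n => φ n r ^ (n / r) * φ n (n % r)) atTop
      (𝓝 (Complex.exp ((((r : ℝ)⁻¹ * z r : ℝ)) : ℂ))) := by
    intro r hr
    have hA : Tendsto (fun n : ℕ => φ n r ^ (n / r) - Complex.exp ((z r : ℂ) / n) ^ (n / r)) atTop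
        (𝓝 0) := by
      have h2 := ((hz r).sub (tendsto_nat_mul_exp_sub_one (z r))).norm
      rw [sub_self, norm_zero] at h2
      refine squeeze_zero_norm' ?_ h2
      filter_upwards with n
      have hb : ‖Complex.exp ((z r : ℂ) / n)‖ ≤ 1 := by
        have : (z r : ℂ) / n = ((z r / n : ℝ) : ℂ) := by push_cast; rfl
        rw [this, Complex.norm_exp_ofReal, Real.exp_le_one_iff]
        exact div_nonpos_of_nonpos_of_nonneg (hz_nonpos r) (Nat.cast_nonneg n)
      refine (norm_pow_sub_pow_le_of_norm_le_one (h1 n r) hb _).trans ?_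
      have e : (n : ℂ) * (φ n r - 1) - n * (Complex.exp ((z r : ℂ) / n) - 1) =
          n * (φ n r - Complex.exp ((z r : ℂ) / n)) := by ring
      rw [e, norm_mul, Complex.norm_natCast]
      gcongr
      exact Nat.div_le_self n r
    have hB : Tendsto (fun n : ℕ => Complex.exp ((z r : ℂ) / n) ^ (n / r)) atTop
        (𝓝 (Complex.exp ((((r : ℝ)⁻¹ * z r : ℝ)) : ℂ))) := by
      have h3 : Tendsto (fun n : ℕ => ((((n / r : ℕ) : ℝ) / n * z r : ℝ) : ℂ)) atTop
          (𝓝 (((r : ℝ)⁻¹ * z r : ℝ) : ℂ)) := by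
        have := (tendsto_nat_div_div hr).mul_const (z r)
        rw [one_div] at this
        exact (Complex.continuous_ofReal.tendsto _).comp this
      refine ((Complex.continuous_exp.tendsto _).comp h3).congr fun n => ?_
      rw [Function.comp, ← Complex.exp_nat_mul]
      congr 1
      push_cast
      ring
    have hC : Tendsto (fun n => φ n (n % r)) atTop (𝓝 1) := by
      rw [Metric.tendsto_nhds]
      intro δ hδ
      have h4 : ∀ᶠ n in atTop, ∀ q ∈ Finset.range r, dist (φ n q) 1 < δ :=
        (Filter.eventually_all_finset _).2 fun q _ => Metric.tendsto_nhds.1 (hlim1 q) δ hδ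
      filter_upwards [h4] with n hn
      exact hn _ (Finset.mem_range.2 (Nat.mod_lt n hr))
    have := (hA.add hB).mul hC
    simpa using this
  rw [Metric.tendsto_nhds]
  intro δ hδ
  have hκ' : Tendsto (fun r : ℕ => |C| * |(r : ℝ)⁻¹ * κ r|) atTop (𝓝 0) := by
    simpa using hκ.abs.const_mul |C|
  have hz₀' := (Complex.continuous_exp.tendsto (z₀ : ℂ)).comp
    ((Complex.continuous_ofReal.tendsto _).comp hz₀)
  obtain ⟨r, hr, hr1, hr2⟩ := ((eventually_gt_atTop 0).and
    ((hκ'.eventually_lt_const (show (0 : ℝ) < δ / 3 by positivity)).and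
      (Metric.tendsto_nhds.1 hz₀' (δ / 3) (by positivity)))).exists
  filter_upwards [hfac, Metric.tendsto_nhds.1 (hpow r hr) (δ / 3) (by positivity),
    eventually_gt_atTop 0] with n hn1 hn2 hn0
  have hn0' : (0 : ℝ) < n := by exact_mod_cast hn0
  have hr0' : (0 : ℝ) < r := by exact_mod_cast hr
  have h5 : ‖φ n n - φ n r ^ (n / r) * φ n (n % r)‖ ≤ |C| * |(r : ℝ)⁻¹ * κ r| := by
    have h6 := norm_block_sub_pow_le (h1 n) (e := C / n * κ r) (hn1 r) (n / r) (n % r)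
    rw [Nat.div_add_mod] at h6
    refine h6.trans ?_
    have h7 : ((n / r : ℕ) : ℝ) / n ≤ (r : ℝ)⁻¹ := by
      rw [div_le_iff₀ hn0', inv_mul_eq_div]
      exact Nat.cast_div_le
    calc ((n / r : ℕ) : ℝ) * (C / n * κ r) = ((n / r : ℕ) : ℝ) / n * (C * κ r) := by ring
      _ ≤ ((n / r : ℕ) : ℝ) / n * (|C| * |κ r|) := by
          rw [← abs_mul]
          exact mul_le_mul_of_nonneg_left (le_abs_self _) (by positivity)
      _ ≤ (r : ℝ)⁻¹ * (|C| * |κ r|) := mul_le_mul_of_nonneg_right h7 (by positivity)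
      _ = |C| * |(r : ℝ)⁻¹ * κ r| := by
          rw [abs_mul, abs_of_pos (inv_pos.2 hr0')]; ring
  rw [← dist_eq_norm] at h5
  simp only [Function.comp] at hr2
  calc dist (φ n n) (Complex.exp z₀)
      ≤ dist (φ n n) (φ n r ^ (n / r) * φ n (n % r)) +
          dist (φ n r ^ (n / r) * φ n (n % r)) (Complex.exp (((r : ℝ)⁻¹ * z r : ℝ) : ℂ)) +
          dist (Complex.exp (((r : ℝ)⁻¹ * z r : ℝ) : ℂ)) (Complex.exp z₀) := dist_triangle4 _ _ _ _
    _ < δ / 3 + δ / 3 + δ / 3 := by gcongr; exact h5.trans_lt hr1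
    _ = δ := by ring

/-- Double sums `∑ a (t - s)` over squares grow linearly. -/
lemma tendsto_inv_mul_sum_sum_sub {a : ℤ → ℝ} {A : ℝ} (h : HasSum a A) :
    Tendsto (fun m : ℕ => (m : ℝ)⁻¹ * ∑ s ∈ Finset.range m, ∑ t ∈ Finset.range m,
      a ((t : ℤ) - s)) atTop (𝓝 A) := by
  have hshell : Tendsto (fun m : ℕ => ∑ j ∈ Finset.Icc (-(m : ℤ)) m, a j) atTop (𝓝 A) := by
    have hf : Tendsto (fun m : ℕ => Finset.Icc (-(m : ℤ)) m) atTop atTop := by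
      refine tendsto_atTop_finset_of_monotone ?_ ?_
      · intro m n hmn
        exact Finset.Icc_subset_Icc (by omega) (by omega)
      · intro j
        exact ⟨j.natAbs, by rw [Finset.mem_Icc]; omega⟩
    exact h.comp hf
  -- the sums over squares are partial sums of the sums over the intervals `[-m, m]`
  refine hshell.cesaro.congr fun m => ?_
  congr 1
  induction m with
  | zero => simp
  | succ m ih =>
    rw [Finset.sum_range_succ, ih, Finset.sum_range_succ]
    simp_rw [Finset.sum_range_succ _ m]
    rw [Finset.sum_add_distrib, add_assoc]
    congr 1
    -- the two new sides of the square make up the interval `[-m, m]`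
    have e1 : ∑ s ∈ Finset.range m, a ((m : ℤ) - s) = ∑ j ∈ Finset.Icc (1 : ℤ) m, a j := by
      refine Finset.sum_bij (fun s _ => (m : ℤ) - s) ?_ ?_ ?_ ?_
      · intro s hs; rw [Finset.mem_range] at hs; rw [Finset.mem_Icc]; omega
      · intro s _ s' _ h; omega
      · intro j hj
        rw [Finset.mem_Icc] at hj
        exact ⟨((m : ℤ) - j).toNat, by rw [Finset.mem_range]; omega, by omega⟩
      · intro s _; rfl
    have e2 : ∑ t ∈ Finset.range m, a ((t : ℤ) - m) + a ((m : ℤ) - m) =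
        ∑ j ∈ Finset.Icc (-(m : ℤ)) 0, a j := by
      rw [← Finset.sum_range_succ (fun t : ℕ => a ((t : ℤ) - m))]
      refine Finset.sum_bij (fun t _ => (t : ℤ) - m) ?_ ?_ ?_ ?_
      · intro s hs; rw [Finset.mem_range] at hs; rw [Finset.mem_Icc]; omega
      · intro s _ s' _ h; omega
      · intro j hj
        rw [Finset.mem_Icc] at hj
        exact ⟨(j + m).toNat, by rw [Finset.mem_range]; omega, by omega⟩
      · intro s _; rfl
    rw [e1, e2, add_comm, ← Finset.sum_union]
    · refine Finset.sum_congr ?_ fun _ _ => rfl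
      ext j
      simp only [Finset.mem_union, Finset.mem_Icc]
      omega
    · rw [Finset.disjoint_left]
      intro j
      simp only [Finset.mem_Icc]
      omega

end Blocks

/-! ### Centred exceedance counts and their characteristic functions -/

section Score

/-- The indicator that the path `y` exceeds the level `u` at all times in `S`. -/
noncomputable def allExceed (u : ℝ) (y : ℤ → ℝ) (S : Finset ℤ) : ℝ :=
  if ∀ t ∈ S, u < y t then 1 else 0

/-- The contribution of time `t` to the centred numerator of the ratio estimator: the indicator of a
joint exceedance on `t + T` minus `π` times the indicator of an exceedance at `t`. -/
noncomputable def score (T : Finset ℤ) (u π : ℝ) (t : ℤ) (y : ℤ → ℝ) : ℝ :=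
  allExceed u y (T.image fun s => t + s) - π * allExceed u y {t}

/-- The score as a function of the set of exceedance times. -/
noncomputable def setScore (T : Finset ℤ) (π : ℝ) (t : ℤ) (A : Finset ℤ) : ℝ :=
  (if (T.image fun s => t + s) ⊆ A then 1 else 0) - π * (if t ∈ A then 1 else 0)

variable {T : Finset ℤ} {u π τ : ℝ} {t : ℤ}

lemma allExceed_nonneg (y : ℤ → ℝ) (S : Finset ℤ) : 0 ≤ allExceed u y S := by
  unfold allExceed; split_ifs <;> norm_num

lemma allExceed_le_one (y : ℤ → ℝ) (S : Finset ℤ) : allExceed u y S ≤ 1 := by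
  unfold allExceed; split_ifs <;> norm_num

lemma allExceed_mul (y : ℤ → ℝ) (S S' : Finset ℤ) :
    allExceed u y S * allExceed u y S' = allExceed u y (S ∪ S') := by
  unfold allExceed
  simp only [Finset.mem_union, or_imp, forall_and]
  split_ifs <;> simp_all

lemma measurable_allExceed (S : Finset ℤ) : Measurable fun y => allExceed u y S := by
  unfold allExceed
  exact Measurable.ite (measurableSet_forall_gt (X := fun t (y : ℤ → ℝ) => y t)
    (fun t => measurable_pi_apply t) S u) measurable_const measurable_const

lemma measurable_score : Measurable (score T u π t) :=
  (measurable_allExceed _).sub ((measurable_allExceed _).const_mul _)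

lemma abs_score_le (h0 : 0 ≤ π) (h1 : π ≤ 1) (y : ℤ → ℝ) : |score T u π t y| ≤ 1 := by
  have ha := allExceed_nonneg (u := u) y (T.image fun s => t + s)
  have hb := allExceed_le_one (u := u) y (T.image fun s => t + s)
  have hc := allExceed_nonneg (u := u) y {t}
  have hd := allExceed_le_one (u := u) y {t}
  rw [score, abs_le]
  constructor <;> nlinarith

lemma score_shift (r : ℤ) (y : ℤ → ℝ) :
    score T u π (r + t) y = score T u π t fun j => y (j + r) := by
  simp only [score, allExceed, Finset.forall_mem_image, Finset.mem_singleton, forall_eq]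
  simp only [add_comm r t, add_right_comm t r]

lemma score_eq_setScore {Ω : Type*} {X : ℤ → Ω → ℝ} {W : Finset ℤ} (hT0 : (0 : ℤ) ∈ T)
    (hW : ∀ s ∈ T, t + s ∈ W) (ω : Ω) :
    score T u π t (fun j => X j ω) = setScore T π t (exceedSet X u W ω) := by
  have ht : t ∈ W := by simpa using hW 0 hT0
  have e : ((T.image fun s => t + s) ⊆ exceedSet X u W ω) ↔
      ∀ j ∈ T.image (fun s => t + s), u < X j ω := by
    simp only [Finset.subset_iff, Finset.forall_mem_image, mem_exceedSet]
    exact forall₂_congr fun s hs => by simp [hW s hs]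
  simp only [score, setScore, allExceed, e, mem_exceedSet, ht, true_and, Finset.mem_singleton,
    forall_eq]

lemma abs_setScore_union_sub_le (hT0 : (0 : ℤ) ∈ T) (h0 : 0 ≤ π) (h1 : π ≤ 1) (A C : Finset ℤ) :
    |setScore T π t (A ∪ C) - setScore T π t A| ≤ 2 * ∑ s ∈ T, if t + s ∈ C then 1 else 0 := by
  by_cases h : ∃ s ∈ T, t + s ∈ C
  · obtain ⟨s, hs, hsC⟩ := h
    have hcount : (1 : ℝ) ≤ ∑ s ∈ T, if t + s ∈ C then 1 else 0 := by
      have := Finset.single_le_sum (f := fun s => if t + s ∈ C then (1 : ℝ) else 0)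
        (fun _ _ => by split_ifs <;> norm_num) hs
      simpa [hsC] using this
    have hb : |setScore T π t (A ∪ C) - setScore T π t A| ≤ 2 := by
      unfold setScore
      rw [abs_le]
      constructor <;> split_ifs <;> linarith
    linarith
  · push Not at h
    have ht : t ∉ C := by simpa using h 0 hT0
    have e : ((T.image fun s => t + s) ⊆ A ∪ C) ↔ (T.image fun s => t + s) ⊆ A := by
      simp only [Finset.subset_iff, Finset.forall_mem_image, Finset.mem_union]
      exact forall₂_congr fun s hs => by simp [h s hs]
    have e' : setScore T π t (A ∪ C) = setScore T π t A := by
      simp only [setScore, e, Finset.mem_union, ht, or_false]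
    rw [e', sub_self, abs_zero]
    exact mul_nonneg zero_le_two (Finset.sum_nonneg fun _ _ => by split_ifs <;> norm_num)

lemma norm_exp_mul_I_sub_le (a b : ℝ) :
    ‖Complex.exp (a * Complex.I) - Complex.exp (b * Complex.I)‖ ≤ |a - b| := by
  have e : Complex.exp (a * Complex.I) - Complex.exp (b * Complex.I) =
      Complex.exp (b * Complex.I) * (Complex.exp (Complex.I * (a - b : ℝ)) - 1) := by
    rw [mul_sub, ← Complex.exp_add]
    push_cast
    ring_nf
  rw [e, norm_mul, Complex.norm_exp_ofReal_mul_I, one_mul]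
  exact Real.norm_exp_I_mul_ofReal_sub_one_le

lemma hitLipschitz_exp_sum_setScore (hT0 : (0 : ℤ) ∈ T) (h0 : 0 ≤ π) (h1 : π ≤ 1) (a : ℤ)
    (r : ℕ) :
    HitLipschitz (2 * |τ|) (Finset.range r ×ˢ T) (fun z => a + z.1 + z.2) fun A =>
      Complex.exp ((τ * ∑ t ∈ Finset.range r, setScore T π (a + t) A : ℝ) * Complex.I) := by
  intro A C
  refine (norm_exp_mul_I_sub_le _ _).trans ?_
  rw [← mul_sub, ← Finset.sum_sub_distrib, abs_mul, hitCount, Finset.sum_product, mul_comm 2,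
    mul_assoc, Finset.mul_sum]
  exact mul_le_mul_of_nonneg_left ((Finset.abs_sum_le_sum_abs _ _).trans
    (Finset.sum_le_sum fun t _ => abs_setScore_union_sub_le hT0 h0 h1 A C)) (abs_nonneg _)

end Score

section BlockCharFun

variable {Ω : Type*} {X : ℤ → Ω → ℝ} {α : ℝ} {T : Finset ℤ} {u π τ : ℝ}

/-- The sum of the scores over the times `0, …, m - 1`. -/
noncomputable def blockSum (X : ℤ → Ω → ℝ) (T : Finset ℤ) (u π : ℝ) (m : ℕ) (ω : Ω) : ℝ :=
  ∑ t ∈ Finset.range m, score T u π t fun j => X j ω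

lemma abs_blockSum_le (h0 : 0 ≤ π) (h1 : π ≤ 1) (m : ℕ) (ω : Ω) :
    |blockSum X T u π m ω| ≤ m := by
  refine (Finset.abs_sum_le_sum_abs _ _).trans ?_
  refine (Finset.sum_le_card_nsmul _ _ 1 fun t _ => abs_score_le h0 h1 _).trans ?_
  simp

variable [MeasurableSpace Ω] {P : Measure Ω}

/-- The characteristic function of `blockSum` at `τ`. -/
noncomputable def blockCharFun (P : Measure Ω) (X : ℤ → Ω → ℝ) (T : Finset ℤ) (u π τ : ℝ)
    (m : ℕ) : ℂ :=
  ∫ ω, Complex.exp ((τ * blockSum X T u π m ω : ℝ) * Complex.I) ∂P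

/-- Total tail dependence between the windows `T` and `h + T`. -/
noncomputable def windowDependence (P : Measure Ω) (X : ℤ → Ω → ℝ) (T : Finset ℤ) (h : ℤ) : ℝ :=
  ∑ s ∈ T, ∑ s' ∈ T, tailCoeff P X {0, h + s' - s}

lemma measurable_score_path (hX : ∀ t, Measurable (X t)) (t : ℤ) :
    Measurable fun ω => score T u π t fun j => X j ω :=
  measurable_score.comp (measurable_pi_lambda _ hX)

lemma measurable_blockSum (hX : ∀ t, Measurable (X t)) (m : ℕ) :
    Measurable (blockSum X T u π m) :=
  Finset.measurable_fun_sum _ fun _ _ => measurable_score_path hX _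

/-- By stationarity, a sum of scores over any block of length `m` is distributed as `blockSum`. -/
lemma identDistrib_blockSum (hstat : IsStationarySeries P X) (r : ℤ)
    (m : ℕ) :
    IdentDistrib (fun ω => ∑ t ∈ Finset.range m, score T u π (r + t) fun j => X j ω)
      (blockSum X T u π m) P P := by
  have h := (hstat r).comp (u := fun y : ℤ → ℝ => ∑ t ∈ Finset.range m, score T u π t y)
    (Finset.measurable_fun_sum _ fun _ _ => measurable_score)
  simp_rw [score_shift]
  exact h

lemma summable_windowDependence (hsum : Summable fun h : ℤ => tailCoeff P X {0, h}) :
    Summable (windowDependence P X T) := by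
  refine summable_sum fun s _ => summable_sum fun s' _ => ?_
  have := (Equiv.addRight (s' - s)).summable_iff.2 hsum
  refine this.congr fun h => ?_
  simp [add_sub_assoc]

/-- The dependence across a cut grows sublinearly in the block length. -/
lemma tendsto_inv_mul_sum_windowDependence :
    Tendsto (fun r : ℕ => (r : ℝ)⁻¹ * ∑ i ∈ Finset.range r, ∑' j : ℕ,
      windowDependence P X T ((i + 1 : ℕ) + j)) atTop (𝓝 0) := by
  have h := tendsto_sum_nat_add fun j : ℕ => windowDependence P X T (j : ℤ)
  refine ((h.comp (tendsto_add_atTop_nat 1)).cesaro).congr fun r => ?_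
  congr 1
  refine Finset.sum_congr rfl fun i _ => tsum_congr fun j => ?_
  congr 1
  push_cast
  ring

variable [IsProbabilityMeasure P]

lemma norm_blockCharFun_le (m : ℕ) : ‖blockCharFun P X T u π τ m‖ ≤ 1 := by
  refine (norm_integral_le_of_norm_le_const (C := 1) (ae_of_all _ fun ω => ?_)).trans (by simp)
  rw [Complex.norm_exp_ofReal_mul_I]

lemma windowDependence_nonneg (hX : ∀ t, Measurable (X t)) (hα : 0 < α)
    (hmax : IsMaxStableSeries P X) (hmarg : HasFrechetMargins P X α) (h : ℤ) :
    0 ≤ windowDependence P X T h :=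
  Finset.sum_nonneg fun _ _ => Finset.sum_nonneg fun _ _ =>
    tailCoeff_nonneg hX hα hmax hmarg (Finset.insert_nonempty _ _)

/-- Cutting off the first `r` scores changes the characteristic function by at most the dependence
between the block and its complement. -/
lemma norm_blockCharFun_add_sub_le (hX : ∀ t, Measurable (X t)) (hα : 0 < α)
    (hstat : IsStationarySeries P X)
    (hmax : IsMaxStableSeries P X) (hmarg : HasFrechetMargins P X α)
    (hsum : Summable fun h : ℤ => tailCoeff P X {0, h}) (hT0 : (0 : ℤ) ∈ T)
    (h0 : 0 ≤ π) (h1 : π ≤ 1) {x : ℝ} (hx : 0 < x) (r l : ℕ) :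
    ‖blockCharFun P X T (x ^ (-1 / α)) π τ (r + l) - blockCharFun P X T (x ^ (-1 / α)) π τ r *
        blockCharFun P X T (x ^ (-1 / α)) π τ l‖ ≤
      4 * τ ^ 2 * x * ∑ i ∈ Finset.range r, ∑' j : ℕ,
        windowDependence P X T ((i + 1 : ℕ) + j) := by
  set u := x ^ (-1 / α) with hu
  set W : Finset ℤ := (Finset.range (r + l) ×ˢ T).image fun z => (z.1 : ℤ) + z.2 with hWdef
  have hW : ∀ t < r + l, ∀ s ∈ T, (t : ℤ) + s ∈ W := fun t ht s hs =>
    Finset.mem_image.2 ⟨(t, s), Finset.mem_product.2 ⟨Finset.mem_range.2 ht, hs⟩, rfl⟩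
  set F : Finset ℤ → ℂ := fun A =>
    Complex.exp ((τ * ∑ t ∈ Finset.range r, setScore T π (0 + t) A : ℝ) * Complex.I) with hF
  set G : Finset ℤ → ℂ := fun A =>
    Complex.exp ((τ * ∑ t ∈ Finset.range l, setScore T π (r + t) A : ℝ) * Complex.I) with hG
  have hsF : ∀ ω, ∑ t ∈ Finset.range r, setScore T π (0 + t) (exceedSet X u W ω) =
      blockSum X T u π r ω := fun ω => Finset.sum_congr rfl fun t ht => by
    rw [zero_add, score_eq_setScore hT0]
    exact hW t (by rw [Finset.mem_range] at ht; omega)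
  have hsG : ∀ ω, ∑ t ∈ Finset.range l, setScore T π (r + t) (exceedSet X u W ω) =
      ∑ t ∈ Finset.range l, score T u π (r + t) fun j => X j ω := fun ω =>
    Finset.sum_congr rfl fun t ht => by
      rw [score_eq_setScore hT0]
      have := hW (r + t) (by rw [Finset.mem_range] at ht; omega)
      push_cast at this
      exact this
  have key := norm_integral_mul_sub_le (P := P) hX hα hmax hmarg W hx
    (I := Finset.range r ×ˢ T) (J := Finset.range l ×ˢ T)
    (p := fun z => 0 + (z.1 : ℤ) + z.2) (q := fun z => (r : ℤ) + z.1 + z.2) (F := F) (G := G)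
    (c := 2 * |τ|) (d := 2 * |τ|)
    (fun z hz => by
      rw [Finset.mem_product, Finset.mem_range] at hz
      rw [zero_add]
      exact hW _ (by omega) _ hz.2)
    (fun z hz => by
      rw [Finset.mem_product, Finset.mem_range] at hz
      have := hW (r + z.1) (by omega) _ hz.2
      push_cast at this
      exact this)
    (by positivity) (hitLipschitz_exp_sum_setScore hT0 h0 h1 0 r)
    (hitLipschitz_exp_sum_setScore hT0 h0 h1 r l)
  have eF : ∫ ω, F (exceedSet X u W ω) ∂P = blockCharFun P X T u π τ r := by
    simp only [hF, hsF, blockCharFun]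
  have eG : ∫ ω, G (exceedSet X u W ω) ∂P = blockCharFun P X T u π τ l := by
    simp only [hG, hsG, blockCharFun]
    have := (identDistrib_blockSum (T := T) (u := u) (π := π) hstat r l).comp
      (u := fun v : ℝ => Complex.exp ((τ * v : ℝ) * Complex.I)) (by fun_prop)
    exact this.integral_eq
  have eFG : ∫ ω, F (exceedSet X u W ω) * G (exceedSet X u W ω) ∂P =
      blockCharFun P X T u π τ (r + l) := by
    simp only [hF, hG, hsF, hsG, blockCharFun]
    refine integral_congr_ae (ae_of_all _ fun ω => ?_)
    simp only []
    rw [← Complex.exp_add, ← add_mul, ← Complex.ofReal_add, ← mul_add]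
    congr 5
    rw [blockSum, blockSum, Finset.sum_range_add]
    push_cast
    rfl
  rw [eF, eG, eFG] at key
  refine key.trans ?_
  have e1 : 2 * |τ| * (2 * |τ|) = 4 * τ ^ 2 := by rw [← sq_abs τ]; ring
  rw [e1, ← mul_assoc]
  refine mul_le_mul_of_nonneg_left ?_ (by positivity)
  have e2 : ∑ a ∈ Finset.range r ×ˢ T, ∑ b ∈ Finset.range l ×ˢ T,
      tailCoeff P X {0 + (a.1 : ℤ) + a.2, (r : ℤ) + b.1 + b.2} =
      ∑ t ∈ Finset.range r, ∑ t' ∈ Finset.range l,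
        windowDependence P X T ((r : ℤ) - t + t') := by
    rw [Finset.sum_product]
    refine Finset.sum_congr rfl fun t _ => ?_
    simp_rw [Finset.sum_product]
    rw [Finset.sum_comm]
    refine Finset.sum_congr rfl fun t' _ => ?_
    refine Finset.sum_congr rfl fun s _ => Finset.sum_congr rfl fun s' _ => ?_
    rw [tailCoeff_pair_eq hstat]
    congr 2
    ring_nf
  rw [e2, ← Finset.sum_range_reflect]
  refine Finset.sum_le_sum fun i hi => ?_
  rw [Finset.mem_range] at hi
  have hinj : Function.Injective fun j : ℕ => ((i + 1 : ℕ) : ℤ) + j := fun j j' h => by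
    simpa using h
  have e3 : ∀ t' : ℕ, (r : ℤ) - ((r - 1 - i : ℕ) : ℤ) + t' = ((i + 1 : ℕ) : ℤ) + t' := by
    intro t'; omega
  simp_rw [e3]
  exact ((summable_windowDependence hsum).comp_injective hinj).sum_le_tsum _
    fun j _ => windowDependence_nonneg hX hα hmax hmarg _

end BlockCharFun

/-! ### Moments of the centred counts -/

section Moments

variable {Ω : Type*} [MeasurableSpace Ω] {P : Measure Ω} {X : ℤ → Ω → ℝ} {α : ℝ} {T : Finset ℤ}

/-- Limit of the normalized covariances of the scores at two times with lag `h`. The asymptotic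
variance is the sum over all lags. -/
noncomputable def scoreCov (P : Measure Ω) (X : ℤ → Ω → ℝ) (T : Finset ℤ) (h : ℤ) : ℝ :=
  tailCoeff P X (T ∪ T.image fun s => h + s) - tailCoeff P X T * tailCoeff P X (T ∪ {h})
    - tailCoeff P X T * tailCoeff P X ({0} ∪ T.image fun s => h + s)
    + tailCoeff P X T ^ 2 * tailCoeff P X {0, h}

lemma tailRatio_nonneg (S : Finset ℤ) (u : ℝ) : 0 ≤ tailRatio P X S u :=
  div_nonneg measureReal_nonneg measureReal_nonneg

lemma tailRatio_singleton (hstat : IsStationarySeries P X) {u : ℝ} (hp : exceedProb P X u ≠ 0)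
    (t : ℤ) : tailRatio P X {t} u = 1 := by
  have h := tailRatio_image_add hstat {0} t u
  rw [Finset.image_singleton, add_zero] at h
  rw [h, tailRatio]
  simpa [exceedProb] using div_self hp

lemma image_union_image_eq (t t' : ℤ) (S S' : Finset ℤ) :
    ((S.image fun s => t + s) ∪ S'.image fun s => t' + s) =
      (S ∪ S'.image fun s => t' - t + s).image fun s => t + s := by
  rw [Finset.image_union, Finset.image_image]
  congr 2
  ext s
  simp only [Function.comp]
  ring

lemma tailCoeff_image_union_image (hstat : IsStationarySeries P X) (t t' : ℤ) (S S' : Finset ℤ) :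
    tailCoeff P X ((S.image fun s => t + s) ∪ S'.image fun s => t' + s) =
      tailCoeff P X (S ∪ S'.image fun s => t' - t + s) := by
  rw [image_union_image_eq, tailCoeff_image_add hstat]

lemma integral_allExceed (hX : ∀ t, Measurable (X t)) {u : ℝ} (hp : exceedProb P X u ≠ 0)
    (S : Finset ℤ) :
    ∫ ω, allExceed u (fun j => X j ω) S ∂P = tailRatio P X S u * exceedProb P X u := by
  rw [tailRatio, div_mul_cancel₀ _ hp, ← integral_indicator_one (measurableSet_forall_gt hX S u)]
  refine integral_congr_ae (ae_of_all _ fun ω => ?_)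
  simp [allExceed, Set.indicator_apply]

variable [IsProbabilityMeasure P]

lemma tailRatio_le_one {S : Finset ℤ} (hS : (0 : ℤ) ∈ S) (u : ℝ) : tailRatio P X S u ≤ 1 :=
  div_le_one_of_le₀ (measureReal_mono fun _ h => h 0 hS) measureReal_nonneg

lemma integrable_allExceed (hX : ∀ t, Measurable (X t)) (u : ℝ) (S : Finset ℤ) :
    Integrable (fun ω => allExceed u (fun j => X j ω) S) P := by
  refine Integrable.of_bound ((measurable_allExceed S).comp
    (measurable_pi_lambda _ hX)).aestronglyMeasurable 1 (ae_of_all _ fun ω => ?_)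
  rw [Real.norm_of_nonneg (allExceed_nonneg _ _)]
  exact allExceed_le_one _ _

lemma integrable_score (hX : ∀ t, Measurable (X t)) (u π : ℝ) (t : ℤ) :
    Integrable (fun ω => score T u π t fun j => X j ω) P :=
  (integrable_allExceed hX u _).sub ((integrable_allExceed hX u _).const_mul _)

lemma integral_score (hX : ∀ t, Measurable (X t)) (hstat : IsStationarySeries P X) {u : ℝ}
    (hp : exceedProb P X u ≠ 0) (t : ℤ) :
    ∫ ω, score T u (tailRatio P X T u) t (fun j => X j ω) ∂P = 0 := by
  simp only [score]
  rw [integral_sub (integrable_allExceed hX u _) ((integrable_allExceed hX u _).const_mul _),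
    integral_const_mul, integral_allExceed hX hp, integral_allExceed hX hp,
    tailRatio_singleton hstat hp, tailRatio_image_add hstat]
  ring

lemma integral_score_mul_score (hX : ∀ t, Measurable (X t)) {u : ℝ}
    (hp : exceedProb P X u ≠ 0) (π : ℝ) (t t' : ℤ) :
    ∫ ω, score T u π t (fun j => X j ω) * score T u π t' (fun j => X j ω) ∂P =
      (tailRatio P X ((T.image fun s => t + s) ∪ T.image fun s => t' + s) u
        - π * tailRatio P X ((T.image fun s => t + s) ∪ {t'}) u
        - π * tailRatio P X ({t} ∪ T.image fun s => t' + s) u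
        + π ^ 2 * tailRatio P X ({t} ∪ {t'}) u) * exceedProb P X u := by
  have e : ∀ ω, score T u π t (fun j => X j ω) * score T u π t' (fun j => X j ω) =
      allExceed u (fun j => X j ω) ((T.image fun s => t + s) ∪ T.image fun s => t' + s)
        - π * allExceed u (fun j => X j ω) ((T.image fun s => t + s) ∪ {t'})
        - π * allExceed u (fun j => X j ω) ({t} ∪ T.image fun s => t' + s)
        + π ^ 2 * allExceed u (fun j => X j ω) ({t} ∪ {t'}) := fun ω => by
    simp only [score, ← allExceed_mul]
    ring
  have hi := fun S => integrable_allExceed (P := P) hX u S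
  have hi1 : ∀ S S', Integrable (fun ω => allExceed u (fun j => X j ω) S -
      π * allExceed u (fun j => X j ω) S') P := fun S S' => (hi S).sub ((hi S').const_mul _)
  have hi2 : ∀ S S' S'', Integrable (fun ω => allExceed u (fun j => X j ω) S -
      π * allExceed u (fun j => X j ω) S' - π * allExceed u (fun j => X j ω) S'') P :=
    fun S S' S'' => (hi1 S S').sub ((hi S'').const_mul _)
  simp_rw [e]
  rw [integral_add (hi2 _ _ _) ((hi _).const_mul _), integral_sub (hi1 _ _) ((hi _).const_mul _),
    integral_sub (hi _) ((hi _).const_mul _), integral_const_mul, integral_const_mul,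
    integral_const_mul, integral_allExceed hX hp, integral_allExceed hX hp,
    integral_allExceed hX hp, integral_allExceed hX hp]
  ring

lemma exceedProb_pos (hX : ∀ t, Measurable (X t)) (hα : 0 < α) (hmarg : HasFrechetMargins P X α)
    {u : ℝ} (hu : 0 < u) : 0 < exceedProb P X u := by
  have h := exceedProb_level hX hα hmarg (Real.rpow_pos_of_pos hu (-α))
  rw [rpow_rpow_level hα hu] at h
  rw [h, sub_pos, Real.exp_lt_one_iff]
  exact neg_lt_zero.2 (Real.rpow_pos_of_pos hu _)

lemma tendsto_integral_score_mul_score (hX : ∀ t, Measurable (X t)) (hα : 0 < α)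
    (hstat : IsStationarySeries P X)
    (hmax : IsMaxStableSeries P X) (hmarg : HasFrechetMargins P X α) (hT0 : (0 : ℤ) ∈ T)
    (t t' : ℤ) :
    Tendsto (fun u => (∫ ω, score T u (tailRatio P X T u) t (fun j => X j ω) *
      score T u (tailRatio P X T u) t' (fun j => X j ω) ∂P) / exceedProb P X u) atTop
      (𝓝 (scoreCov P X T (t' - t))) := by
  have hlim : ∀ S : Finset ℤ, S.Nonempty → Tendsto (tailRatio P X S) atTop (𝓝 (tailCoeff P X S)) :=
    fun S hS => tendsto_tailRatio hX hα hmax hmarg hS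
  have hT : T.Nonempty := ⟨0, hT0⟩
  have hsing : ∀ t : ℤ, ({t} : Finset ℤ) = ({0} : Finset ℤ).image fun s => t + s := by simp
  have e : scoreCov P X T (t' - t) =
      tailCoeff P X ((T.image fun s => t + s) ∪ T.image fun s => t' + s)
        - tailCoeff P X T * tailCoeff P X ((T.image fun s => t + s) ∪ {t'})
        - tailCoeff P X T * tailCoeff P X ({t} ∪ T.image fun s => t' + s)
        + tailCoeff P X T ^ 2 * tailCoeff P X ({t} ∪ {t'}) := by
    rw [hsing t, hsing t', tailCoeff_image_union_image hstat, tailCoeff_image_union_image hstat,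
      tailCoeff_image_union_image hstat, tailCoeff_image_union_image hstat, scoreCov]
    simp only [Finset.image_singleton, add_zero, Finset.singleton_union]
  rw [e]
  refine ((((hlim _ ?_).sub ((hlim T hT).mul (hlim _ ?_))).sub
    ((hlim T hT).mul (hlim _ ?_))).add (((hlim T hT).pow 2).mul (hlim _ ?_))).congr' ?_
  · exact (hT.image _).inl
  · exact (hT.image _).inl
  · exact (Finset.singleton_nonempty t).inl
  · exact (Finset.singleton_nonempty t).inl
  · filter_upwards [eventually_gt_atTop 0] with u hu
    have hp := (exceedProb_pos hX hα hmarg hu).ne'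
    rw [integral_score_mul_score hX hp, mul_div_cancel_right₀ _ hp]

lemma integral_blockSum (hX : ∀ t, Measurable (X t)) (hstat : IsStationarySeries P X) {u : ℝ}
    (hp : exceedProb P X u ≠ 0) (m : ℕ) :
    ∫ ω, blockSum X T u (tailRatio P X T u) m ω ∂P = 0 := by
  simp only [blockSum]
  rw [integral_finsetSum _ fun (t : ℕ) _ => integrable_score hX u _ (t : ℤ)]
  exact Finset.sum_eq_zero fun t _ => integral_score hX hstat hp t

lemma integrable_blockSum_pow (hX : ∀ t, Measurable (X t)) {u π : ℝ} (h0 : 0 ≤ π) (h1 : π ≤ 1)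
    (m k : ℕ) : Integrable (fun ω => blockSum X T u π m ω ^ k) P := by
  refine Integrable.of_bound ((measurable_blockSum hX m).pow_const k).aestronglyMeasurable
    ((m : ℝ) ^ k) (ae_of_all _ fun ω => ?_)
  rw [norm_pow]
  exact pow_le_pow_left₀ (norm_nonneg _) (abs_blockSum_le h0 h1 m ω) k

lemma tendsto_integral_blockSum_sq (hX : ∀ t, Measurable (X t)) (hα : 0 < α)
    (hstat : IsStationarySeries P X)
    (hmax : IsMaxStableSeries P X) (hmarg : HasFrechetMargins P X α) (hT0 : (0 : ℤ) ∈ T) (m : ℕ) :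
    Tendsto (fun u => (∫ ω, blockSum X T u (tailRatio P X T u) m ω ^ 2 ∂P) / exceedProb P X u)
      atTop (𝓝 (∑ s ∈ Finset.range m, ∑ t ∈ Finset.range m, scoreCov P X T ((t : ℤ) - s))) := by
  refine (tendsto_finsetSum _ fun (s : ℕ) _ => tendsto_finsetSum _ fun (t : ℕ) _ =>
    tendsto_integral_score_mul_score hX hα hstat hmax hmarg hT0 s t).congr fun u => ?_
  simp only [← Finset.sum_div, blockSum, sq, Finset.sum_mul_sum]
  have hi : ∀ s t : ℤ, Integrable (fun ω => score T u (tailRatio P X T u) s (fun j => X j ω) *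
      score T u (tailRatio P X T u) t (fun j => X j ω)) P := fun s t =>
    (integrable_score hX u _ t).bdd_mul (c := 1) (measurable_score_path hX s).aestronglyMeasurable
      (ae_of_all _ fun ω => abs_score_le (tailRatio_nonneg _ _) (tailRatio_le_one hT0 _) _)
  rw [integral_finsetSum _ fun (s : ℕ) _ => integrable_finsetSum _ fun (t : ℕ) _ => hi s t]
  congr 1
  exact Finset.sum_congr rfl fun s _ => (integral_finsetSum _ fun (t : ℕ) _ => hi s t).symm

/-- Second-order expansion of the characteristic function of a block of fixed length. -/
lemma norm_blockCharFun_sub_one_add_le (hX : ∀ t, Measurable (X t))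
    (hstat : IsStationarySeries P X) (hT0 : (0 : ℤ) ∈ T) {u τ : ℝ}
    (hp : exceedProb P X u ≠ 0) {m : ℕ} (hτ : |τ| * m ≤ 1) :
    ‖blockCharFun P X T u (tailRatio P X T u) τ m - 1 +
        (τ ^ 2 / 2 * ∫ ω, blockSum X T u (tailRatio P X T u) m ω ^ 2 ∂P : ℝ)‖ ≤
      |τ| ^ 3 * m * ∫ ω, blockSum X T u (tailRatio P X T u) m ω ^ 2 ∂P := by
  set π := tailRatio P X T u with hπ
  have h0 : 0 ≤ π := tailRatio_nonneg _ _
  have h1 : π ≤ 1 := tailRatio_le_one hT0 _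
  set B := blockSum X T u π m with hB
  have hBm : Measurable B := measurable_blockSum hX m
  have hI2 : Integrable (fun ω => B ω ^ 2) P := integrable_blockSum_pow hX h0 h1 m 2
  have hI1 : Integrable B P := by simpa using integrable_blockSum_pow (P := P) hX h0 h1 m 1
  have hIe : Integrable (fun ω => Complex.exp ((τ * B ω : ℝ) * Complex.I)) P := by
    refine Integrable.of_bound (by fun_prop) 1 (ae_of_all _ fun ω => ?_)
    rw [Complex.norm_exp_ofReal_mul_I]
  have hmean : ∫ ω, ((B ω : ℝ) : ℂ) ∂P = 0 := by
    rw [integral_complex_ofReal, integral_blockSum hX hstat hp, Complex.ofReal_zero]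
  have e : blockCharFun P X T u π τ m - 1 + (τ ^ 2 / 2 * ∫ ω, B ω ^ 2 ∂P : ℝ) =
      ∫ ω, (Complex.exp ((τ * B ω : ℝ) * Complex.I) - 1 - (τ * Complex.I) * (B ω : ℝ) +
        ((τ ^ 2 / 2 * B ω ^ 2 : ℝ) : ℂ)) ∂P := by
    have hi1 : Integrable (fun ω => Complex.exp ((τ * B ω : ℝ) * Complex.I) - 1) P :=
      hIe.sub (integrable_const 1)
    have hi2 : Integrable (fun ω => (τ * Complex.I) * ((B ω : ℝ) : ℂ)) P := hI1.ofReal.const_mul _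
    have hi3 : Integrable (fun ω => Complex.exp ((τ * B ω : ℝ) * Complex.I) - 1 -
        (τ * Complex.I) * (B ω : ℝ)) P := hi1.sub hi2
    have hi4 : Integrable (fun ω => ((τ ^ 2 / 2 * B ω ^ 2 : ℝ) : ℂ)) P := (hI2.const_mul _).ofReal
    rw [integral_add hi3 hi4, integral_sub hi1 hi2,
      integral_sub hIe (integrable_const 1), integral_const_mul, hmean,
      integral_complex_ofReal, integral_const_mul]
    simp [blockCharFun, hB]
  rw [e, ← integral_const_mul]
  refine norm_integral_le_of_norm_le (hI2.const_mul _) (ae_of_all _ fun ω => ?_)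
  have hBω : |B ω| ≤ m := abs_blockSum_le h0 h1 m ω
  have hy : ‖((τ * B ω : ℝ) : ℂ) * Complex.I‖ = |τ| * |B ω| := by
    rw [norm_mul, Complex.norm_I, mul_one, Complex.norm_real, Real.norm_eq_abs, abs_mul]
  have hy1 : |τ| * |B ω| ≤ 1 :=
    (mul_le_mul_of_nonneg_left hBω (abs_nonneg _)).trans hτ
  have hexp := Complex.exp_bound (x := ((τ * B ω : ℝ) : ℂ) * Complex.I) (by rw [hy]; exact hy1)
    (n := 3) (by norm_num)
  rw [hy] at hexp
  have e2 : Complex.exp ((τ * B ω : ℝ) * Complex.I) - 1 - (τ * Complex.I) * (B ω : ℝ) +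
        ((τ ^ 2 / 2 * B ω ^ 2 : ℝ) : ℂ) = Complex.exp ((τ * B ω : ℝ) * Complex.I) -
      ∑ k ∈ Finset.range 3, (((τ * B ω : ℝ) : ℂ) * Complex.I) ^ k / (k.factorial : ℂ) := by
    simp only [Finset.sum_range_succ, Finset.range_zero, Finset.sum_empty, Nat.factorial]
    push_cast
    ring_nf
    rw [Complex.I_sq]
    ring
  rw [e2]
  refine hexp.trans ?_
  have h3 : (|τ| * |B ω|) ^ 3 ≤ |τ| ^ 3 * m * B ω ^ 2 := by
    have : (|τ| * |B ω|) ^ 3 = |τ| ^ 3 * |B ω| * B ω ^ 2 := by rw [← sq_abs (B ω)]; ring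
    rw [this]
    gcongr
  refine (mul_le_of_le_one_right (by positivity) ?_).trans h3
  norm_num [Nat.factorial]

/-- First-order asymptotics of the characteristic function of a block of fixed length. -/
lemma tendsto_mul_blockCharFun_sub_one (hX : ∀ t, Measurable (X t)) (hα : 0 < α)
    (hstat : IsStationarySeries P X)
    (hmax : IsMaxStableSeries P X) (hmarg : HasFrechetMargins P X α) (hT0 : (0 : ℤ) ∈ T)
    {u : ℕ → ℝ} (hu : Tendsto u atTop atTop)
    (hnp : Tendsto (fun n : ℕ => (n : ℝ) * exceedProb P X (u n)) atTop atTop) (s : ℝ) (m : ℕ) :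
    Tendsto (fun n : ℕ => (n : ℂ) * (blockCharFun P X T (u n) (tailRatio P X T (u n))
        (s * (√((n : ℝ) * exceedProb P X (u n)))⁻¹) m - 1)) atTop
      (𝓝 ((-(s ^ 2 / 2 * ∑ i ∈ Finset.range m, ∑ j ∈ Finset.range m,
        scoreCov P X T ((j : ℤ) - i)) : ℝ) : ℂ)) := by
  set V := ∑ i ∈ Finset.range m, ∑ j ∈ Finset.range m, scoreCov P X T ((j : ℤ) - i) with hV
  set τ : ℕ → ℝ := fun n => s * (√((n : ℝ) * exceedProb P X (u n)))⁻¹ with hτdef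
  set E : ℕ → ℝ := fun n => ∫ ω, blockSum X T (u n) (tailRatio P X T (u n)) m ω ^ 2 ∂P with hE
  have hEV : Tendsto (fun n => E n / exceedProb P X (u n)) atTop (𝓝 V) :=
    (tendsto_integral_blockSum_sq hX hα hstat hmax hmarg hT0 m).comp hu
  have hτ0 : Tendsto τ atTop (𝓝 0) := by
    have := (tendsto_inv_atTop_zero.comp (Real.tendsto_sqrt_atTop.comp hnp)).const_mul s
    rwa [mul_zero] at this
  have hsq : ∀ᶠ n : ℕ in atTop,
      (n : ℝ) * (τ n ^ 2 * E n) = s ^ 2 * (E n / exceedProb P X (u n)) := by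
    filter_upwards [hnp.eventually_gt_atTop 0] with n hn
    have hn0 : (n : ℝ) ≠ 0 := fun h => by simp [h] at hn
    have hp0 : exceedProb P X (u n) ≠ 0 := fun h => by simp [h] at hn
    rw [hτdef, mul_pow, inv_pow, Real.sq_sqrt hn.le]
    field_simp
  have hmain : Tendsto (fun n : ℕ => -((s ^ 2 / 2) * (E n / exceedProb P X (u n)))) atTop
      (𝓝 (-(s ^ 2 / 2 * V))) := (hEV.const_mul _).neg
  have hmainC := (Complex.continuous_ofReal.tendsto _).comp hmain
  have herr : Tendsto (fun n : ℕ => |τ n| * m * (s ^ 2 * (E n / exceedProb P X (u n)))) atTop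
      (𝓝 0) := by
    have h := (hτ0.abs.mul_const (m : ℝ)).mul (hEV.const_mul (s ^ 2))
    simpa using h
  have hdiff : Tendsto (fun n : ℕ => (n : ℂ) * (blockCharFun P X T (u n)
      (tailRatio P X T (u n)) (τ n) m - 1) -
      ((-((s ^ 2 / 2) * (E n / exceedProb P X (u n))) : ℝ) : ℂ)) atTop (𝓝 0) := by
    refine squeeze_zero_norm' ?_ herr
    have hτm : Tendsto (fun n => |τ n| * m) atTop (𝓝 0) := by
      simpa using hτ0.abs.mul_const (m : ℝ)
    filter_upwards [hsq, hnp.eventually_gt_atTop 0, hτm.eventually_le_const one_pos] with n h1 h2 h3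
    have hp0 : exceedProb P X (u n) ≠ 0 := fun h => by simp [h] at h2
    have h4 := norm_blockCharFun_sub_one_add_le (P := P) (T := T) hX hstat hT0 hp0 h3
    have e1 : (n : ℂ) * (blockCharFun P X T (u n) (tailRatio P X T (u n)) (τ n) m - 1) -
        ((-((s ^ 2 / 2) * (E n / exceedProb P X (u n))) : ℝ) : ℂ) =
        n * (blockCharFun P X T (u n) (tailRatio P X T (u n)) (τ n) m - 1 +
          (τ n ^ 2 / 2 * E n : ℝ)) := by
      have : (s ^ 2 / 2) * (E n / exceedProb P X (u n)) = n * (τ n ^ 2 / 2 * E n) := by linarith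
      rw [this]
      push_cast
      ring
    rw [e1, norm_mul, Complex.norm_natCast]
    calc (n : ℝ) * _ ≤ n * (|τ n| ^ 3 * m * E n) := mul_le_mul_of_nonneg_left h4 (Nat.cast_nonneg n)
      _ = |τ n| * m * (n * (τ n ^ 2 * E n)) := by rw [← sq_abs (τ n)]; ring
      _ = _ := by rw [h1]
  have h := hdiff.add hmainC
  rw [zero_add] at h
  exact h.congr fun n => sub_add_cancel _ _

end Moments

/-! ### The asymptotic variance and the central limit theorem for the centred counts -/

section CLT

variable {Ω : Type*} [MeasurableSpace Ω] {P : Measure Ω} {X : ℤ → Ω → ℝ} {α : ℝ} {T : Finset ℤ}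

lemma tailCoeff_singleton_union_image (hstat : IsStationarySeries P X) (h : ℤ) :
    tailCoeff P X ({0} ∪ T.image fun s => h + s) = tailCoeff P X (T ∪ {-h}) := by
  rw [← tailCoeff_image_add hstat (T ∪ {-h}) h, Finset.image_union, Finset.union_comm]
  simp

variable [IsProbabilityMeasure P]

/-- Tail dependence coefficients of sets containing `0` and `h` are dominated by the pairwise
ones. -/
lemma summable_tailCoeff_of_subset (hX : ∀ t, Measurable (X t)) (hα : 0 < α)
    (hmax : IsMaxStableSeries P X) (hmarg : HasFrechetMargins P X α)
    (hsum : Summable fun h : ℤ => tailCoeff P X {0, h}) {S : ℤ → Finset ℤ}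
    (hS : ∀ h, {0, h} ⊆ S h) : Summable fun h => tailCoeff P X (S h) :=
  hsum.of_nonneg_of_le
    (fun h => tailCoeff_nonneg hX hα hmax hmarg ((Finset.insert_nonempty _ _).mono (hS h)))
    fun h => tailCoeff_anti hX hα hmax hmarg (Finset.insert_nonempty _ _) (hS h)

lemma summable_varTerm (hX : ∀ t, Measurable (X t)) (hα : 0 < α)
    (hmax : IsMaxStableSeries P X) (hmarg : HasFrechetMargins P X α)
    (hsum : Summable fun h : ℤ => tailCoeff P X {0, h}) (hT0 : (0 : ℤ) ∈ T) :
    Summable (varTerm P X T) := by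
  have h1 := summable_tailCoeff_of_subset hX hα hmax hmarg hsum
    (S := fun h => T ∪ T.image fun s => h + s) fun h => by
      refine Finset.insert_subset (Finset.mem_union_left _ hT0) (Finset.singleton_subset_iff.2 ?_)
      exact Finset.mem_union_right _ (Finset.mem_image.2 ⟨0, hT0, add_zero h⟩)
  have h2 := summable_tailCoeff_of_subset hX hα hmax hmarg hsum
    (S := fun h => T ∪ {h}) fun h => by
      refine Finset.insert_subset (Finset.mem_union_left _ hT0) (Finset.singleton_subset_iff.2 ?_)
      exact Finset.mem_union_right _ (Finset.mem_singleton_self h)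
  exact (h1.sub (h2.mul_left _)).add (hsum.mul_left _)

/-- The series of the lag terms and the series of the limiting covariances have the same sum, as
their terms differ by an odd function of the lag. -/
lemma hasSum_scoreCov (hX : ∀ t, Measurable (X t)) (hα : 0 < α) (hstat : IsStationarySeries P X)
    (hmax : IsMaxStableSeries P X) (hmarg : HasFrechetMargins P X α)
    (hsum : Summable fun h : ℤ => tailCoeff P X {0, h}) (hT0 : (0 : ℤ) ∈ T) :
    HasSum (scoreCov P X T) (∑' h, varTerm P X T h) := by
  have h2 := (summable_tailCoeff_of_subset hX hα hmax hmarg hsum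
    (S := fun h => T ∪ {h}) fun h => by
      refine Finset.insert_subset (Finset.mem_union_left _ hT0) (Finset.singleton_subset_iff.2 ?_)
      exact Finset.mem_union_right _ (Finset.mem_singleton_self h)).hasSum
  have h3 := (Equiv.neg ℤ).hasSum_iff.2 h2
  have h4 := (summable_varTerm hX hα hmax hmarg hsum hT0).hasSum.add
    ((h2.sub h3).mul_left (tailCoeff P X T))
  rw [sub_self, mul_zero, add_zero] at h4
  have e : scoreCov P X T = fun h => varTerm P X T h + tailCoeff P X T *
      (tailCoeff P X (T ∪ {h}) - ((fun h => tailCoeff P X (T ∪ {h})) ∘ Equiv.neg ℤ) h) := by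
    ext h
    simp only [scoreCov, varTerm, Function.comp, Equiv.neg_apply]
    rw [tailCoeff_singleton_union_image hstat]
    ring
  rw [e]
  exact h4

lemma sum_sum_scoreCov_nonneg (hX : ∀ t, Measurable (X t)) (hα : 0 < α)
    (hstat : IsStationarySeries P X)
    (hmax : IsMaxStableSeries P X) (hmarg : HasFrechetMargins P X α) (hT0 : (0 : ℤ) ∈ T) (m : ℕ) :
    0 ≤ ∑ s ∈ Finset.range m, ∑ t ∈ Finset.range m, scoreCov P X T ((t : ℤ) - s) :=
  ge_of_tendsto' (tendsto_integral_blockSum_sq hX hα hstat hmax hmarg hT0 m) fun _ =>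
    div_nonneg (integral_nonneg fun _ => sq_nonneg _) measureReal_nonneg

/-- The asymptotic variance is a limit of normalized second moments. -/
lemma tsum_varTerm_nonneg (hX : ∀ t, Measurable (X t)) (hα : 0 < α)
    (hstat : IsStationarySeries P X)
    (hmax : IsMaxStableSeries P X) (hmarg : HasFrechetMargins P X α)
    (hsum : Summable fun h : ℤ => tailCoeff P X {0, h}) (hT0 : (0 : ℤ) ∈ T) :
    0 ≤ ∑' h, varTerm P X T h :=
  ge_of_tendsto' (tendsto_inv_mul_sum_sum_sub (hasSum_scoreCov hX hα hstat hmax hmarg hsum hT0))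
    fun m => mul_nonneg (by positivity) (sum_sum_scoreCov_nonneg hX hα hstat hmax hmarg hT0 m)

/-- Convergence of the characteristic functions of the normalized centred counts. -/
lemma tendsto_blockCharFun (hX : ∀ t, Measurable (X t)) (hα : 0 < α)
    (hstat : IsStationarySeries P X)
    (hmax : IsMaxStableSeries P X) (hmarg : HasFrechetMargins P X α)
    (hsum : Summable fun h : ℤ => tailCoeff P X {0, h}) (hT0 : (0 : ℤ) ∈ T)
    {u : ℕ → ℝ} (hu : Tendsto u atTop atTop)
    (hnp : Tendsto (fun n : ℕ => (n : ℝ) * exceedProb P X (u n)) atTop atTop) (s : ℝ) :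
    Tendsto (fun n : ℕ => blockCharFun P X T (u n) (tailRatio P X T (u n))
        (s * (√((n : ℝ) * exceedProb P X (u n)))⁻¹) n) atTop
      (𝓝 (Complex.exp ((-(s ^ 2 / 2 * ∑' h, varTerm P X T h) : ℝ) : ℂ))) := by
  refine tendsto_of_block_factorization
    (φ := fun n m => blockCharFun P X T (u n) (tailRatio P X T (u n))
        (s * (√((n : ℝ) * exceedProb P X (u n)))⁻¹) m)
    (κ := fun r => ∑ i ∈ Finset.range r, ∑' j : ℕ, windowDependence P X T ((i + 1 : ℕ) + j))
    (C := 8 * s ^ 2) (fun n m => norm_blockCharFun_le m) ?_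
    tendsto_inv_mul_sum_windowDependence
    (fun m => tendsto_mul_blockCharFun_sub_one hX hα hstat hmax hmarg hT0 hu hnp s m)
    (fun m => ?_) ?_
  · filter_upwards [hu.eventually_ge_atTop 1, hnp.eventually_gt_atTop 0] with n hu1 hn r l
    have hu0 : 0 < u n := one_pos.trans_le hu1
    set x := u n ^ (-α) with hx
    have hx0 : 0 < x := Real.rpow_pos_of_pos hu0 _
    have hx1 : x ≤ 1 := Real.rpow_le_one_of_one_le_of_nonpos hu1 (neg_nonpos.2 hα.le)
    have hux : u n = x ^ (-1 / α) := (rpow_rpow_level hα hu0).symm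
    have hp : x / 2 ≤ exceedProb P X (u n) := by
      rw [hux, exceedProb_level hX hα hmarg hx0]
      exact half_le_one_sub_exp hx0 hx1
    have hp0 : 0 < exceedProb P X (u n) := by linarith
    have hn0 : (0 : ℝ) < n := pos_of_mul_pos_left hn hp0.le
    have key := norm_blockCharFun_add_sub_le (π := tailRatio P X T (u n))
      (τ := s * (√((n : ℝ) * exceedProb P X (u n)))⁻¹) hX hα hstat hmax hmarg hsum hT0
      (tailRatio_nonneg _ _) (tailRatio_le_one hT0 _) hx0 r l
    rw [← hux] at key
    refine key.trans (mul_le_mul_of_nonneg_right ?_ (Finset.sum_nonneg fun i _ =>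
      tsum_nonneg fun j => windowDependence_nonneg hX hα hmax hmarg _))
    rw [mul_pow, inv_pow, Real.sq_sqrt hn.le, mul_inv]
    -- `x ≤ 2 p` because `x ≤ 1`, so the factor `4` becomes `8`
    calc 4 * (s ^ 2 * ((n : ℝ)⁻¹ * (exceedProb P X (u n))⁻¹)) * x
        = 4 * s ^ 2 / n * (x / exceedProb P X (u n)) := by field_simp
      _ ≤ 4 * s ^ 2 / n * 2 := by
          refine mul_le_mul_of_nonneg_left ?_ (by positivity)
          rw [div_le_iff₀ hp0]
          linarith
      _ = 8 * s ^ 2 / n := by ring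
  · exact neg_nonpos.2 (mul_nonneg (by positivity)
      (sum_sum_scoreCov_nonneg hX hα hstat hmax hmarg hT0 m))
  · refine ((tendsto_inv_mul_sum_sum_sub
      (hasSum_scoreCov hX hα hstat hmax hmarg hsum hT0)).const_mul (s ^ 2 / 2)).neg.congr
        fun m => ?_
    ring

/-- The central limit theorem for the normalized sums of scores. -/
theorem tendstoInDistribution_sum_score (hX : ∀ t, Measurable (X t)) (hα : 0 < α)
    (hstat : IsStationarySeries P X)
    (hmax : IsMaxStableSeries P X) (hmarg : HasFrechetMargins P X α)
    (hsum : Summable fun h : ℤ => tailCoeff P X {0, h}) (hT0 : (0 : ℤ) ∈ T)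
    {u : ℕ → ℝ} (hu : Tendsto u atTop atTop)
    (hnp : Tendsto (fun n : ℕ => (n : ℝ) * exceedProb P X (u n)) atTop atTop) {σ2 : ℝ≥0}
    (hσ : HasSum (varTerm P X T) (σ2 : ℝ)) :
    TendstoInDistribution (fun (n : ℕ) (ω : Ω) => (√((n : ℝ) * exceedProb P X (u n)))⁻¹ *
        ∑ t ∈ Finset.Icc 1 n, score T (u n) (tailRatio P X T (u n)) t fun j => X j ω)
      atTop (id : ℝ → ℝ) (fun _ => P) (gaussianReal 0 σ2) where
  forall_aemeasurable n := ((Finset.measurable_fun_sum _ fun _ _ =>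
    measurable_score_path hX _).const_mul _).aemeasurable
  tendsto := by
    refine ProbabilityMeasure.tendsto_iff_tendsto_charFun.2 fun s => ?_
    have h := tendsto_blockCharFun hX hα hstat hmax hmarg hsum hT0 hu hnp s
    rw [hσ.tsum_eq] at h
    have elim : charFun ((gaussianReal 0 σ2).map (id : ℝ → ℝ)) s =
        Complex.exp ((-(s ^ 2 / 2 * (σ2 : ℝ)) : ℝ) : ℂ) := by
      rw [Measure.map_id, charFun_gaussianReal]
      congr 1
      push_cast
      ring
    simp only [ProbabilityMeasure.coe_mk]
    rw [elim]
    refine h.congr fun n => ?_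
    rw [charFun_apply_real, integral_map ((Finset.measurable_fun_sum _ fun _ _ =>
      measurable_score_path hX _).const_mul _).aemeasurable (by fun_prop)]
    have hid := ((identDistrib_blockSum (T := T) (u := u n) (π := tailRatio P X T (u n)) hstat 1
      n).comp (u := fun v : ℝ => Complex.exp ((s * (√((n : ℝ) * exceedProb P X (u n)))⁻¹ * v : ℝ) *
        Complex.I)) (by fun_prop)).integral_eq
    rw [blockCharFun]
    refine Eq.trans hid.symm (integral_congr_ae (ae_of_all _ fun ω => ?_))
    simp only [Function.comp]
    have e : ∑ t ∈ Finset.Icc 1 n, score T (u n) (tailRatio P X T (u n)) (t : ℤ) (fun j => X j ω) =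
        ∑ t ∈ Finset.range n, score T (u n) (tailRatio P X T (u n)) (1 + t) fun j => X j ω := by
      rw [← Finset.Ico_succ_right_eq_Icc, Finset.sum_Ico_eq_sum_range]
      simp
    rw [e]
    congr 2
    push_cast
    ring

end CLT

section LLN

variable {Ω : Type*} [MeasurableSpace Ω] {P : Measure Ω} [IsProbabilityMeasure P]
  {X : ℤ → Ω → ℝ} {α : ℝ}

/-- The number of times in `I` at which the path exceeds the level `u`. -/
noncomputable def exceedCount (X : ℤ → Ω → ℝ) (u : ℝ) (I : Finset ℕ) (ω : Ω) : ℝ :=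
  ∑ t ∈ I, allExceed u (fun j => X j ω) {(t : ℤ)}

lemma measurable_exceedCount (hX : ∀ t, Measurable (X t)) (u : ℝ) (I : Finset ℕ) :
    Measurable (exceedCount X u I) :=
  Finset.measurable_fun_sum _ fun _ _ =>
    (measurable_allExceed _).comp (measurable_pi_lambda _ hX)

lemma integral_exceedCount (hX : ∀ t, Measurable (X t)) (hstat : IsStationarySeries P X) {u : ℝ}
    (hp : exceedProb P X u ≠ 0) (I : Finset ℕ) :
    ∫ ω, exceedCount X u I ω ∂P = I.card * exceedProb P X u := by
  simp only [exceedCount]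
  rw [integral_finsetSum _ fun (t : ℕ) _ => integrable_allExceed hX u {(t : ℤ)}]
  simp [integral_allExceed hX hp, tailRatio_singleton hstat hp]

lemma memLp_exceedCount (hX : ∀ t, Measurable (X t)) (u : ℝ) (I : Finset ℕ) :
    MemLp (exceedCount X u I) 2 P := by
  refine MemLp.of_bound (measurable_exceedCount hX u I).aestronglyMeasurable I.card
    (ae_of_all _ fun ω => ?_)
  rw [exceedCount, Real.norm_of_nonneg (Finset.sum_nonneg fun _ _ => allExceed_nonneg _ _)]
  simpa using Finset.sum_le_card_nsmul I _ 1 fun t _ => allExceed_le_one (u := u) (fun j => X j ω) _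

/-- The variance of the number of exceedances is at most of the order of its mean. -/
lemma variance_exceedCount_le (hX : ∀ t, Measurable (X t)) (hα : 0 < α)
    (hstat : IsStationarySeries P X)
    (hmax : IsMaxStableSeries P X) (hmarg : HasFrechetMargins P X α)
    (hsum : Summable fun h : ℤ => tailCoeff P X {0, h}) {x : ℝ} (hx : 0 < x) (I : Finset ℕ) :
    variance (exceedCount X (x ^ (-1 / α)) I) P ≤
      x * (I.card * ∑' h : ℤ, tailCoeff P X {0, h}) := by
  set u := x ^ (-1 / α) with hu
  set W : Finset ℤ := I.image fun t : ℕ => (t : ℤ) with hW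
  set F : Finset ℤ → ℂ := fun A => ((hitCount I (fun t : ℕ => (t : ℤ)) A : ℝ) : ℂ) with hF
  have hmem : ∀ t ∈ I, (t : ℤ) ∈ W := fun t ht => Finset.mem_image_of_mem _ ht
  have hLip : HitLipschitz 1 I (fun t : ℕ => (t : ℤ)) F := by
    intro A C
    simp only [hF]
    rw [← Complex.ofReal_sub, Complex.norm_real, Real.norm_eq_abs, one_mul]
    simp only [hitCount]
    rw [← Finset.sum_sub_distrib]
    refine (Finset.abs_sum_le_sum_abs _ _).trans (Finset.sum_le_sum fun t _ => ?_)
    by_cases hA : (t : ℤ) ∈ A <;> by_cases hC : (t : ℤ) ∈ C <;> simp [hA, hC]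
  have hFω : ∀ ω, F (exceedSet X u W ω) = ((exceedCount X u I ω : ℝ) : ℂ) := by
    intro ω
    simp only [hF, hitCount, exceedCount, allExceed]
    congr 1
    exact Finset.sum_congr rfl fun t ht => by simp [mem_exceedSet, hmem t ht]
  have key := norm_integral_mul_sub_le (P := P) hX hα hmax hmarg W hx hmem hmem (by norm_num)
    hLip hLip
  rw [← hu] at key
  simp_rw [hFω, ← Complex.ofReal_mul] at key
  rw [integral_complex_ofReal, integral_complex_ofReal, ← Complex.ofReal_mul,
    ← Complex.ofReal_sub, Complex.norm_real, Real.norm_eq_abs, one_mul, one_mul] at key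
  rw [variance_eq_sub (memLp_exceedCount hX u I)]
  have h1 := (le_abs_self _).trans key
  simp only [Pi.pow_apply, sq]
  refine h1.trans (mul_le_mul_of_nonneg_left ?_ hx.le)
  rw [← nsmul_eq_mul]
  refine Finset.sum_le_card_nsmul _ _ _ fun t _ => ?_
  rw [Finset.sum_congr rfl fun (t' : ℕ) _ => tailCoeff_pair_eq hstat (t : ℤ) t']
  have hinj : Set.InjOn (fun t' : ℕ => (t' : ℤ) - t) I := fun a _ b _ h => by
    simpa using h
  rw [← Finset.sum_image (f := fun h : ℤ => tailCoeff P X {0, h}) hinj]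
  exact hsum.sum_le_tsum _ fun h _ =>
    tailCoeff_nonneg hX hα hmax hmarg (Finset.insert_nonempty _ _)

/-- The number of exceedances is asymptotically equivalent, in probability, to its mean. -/
theorem tendstoInMeasure_exceedCount_div (hX : ∀ t, Measurable (X t)) (hα : 0 < α)
    (hstat : IsStationarySeries P X)
    (hmax : IsMaxStableSeries P X) (hmarg : HasFrechetMargins P X α)
    (hsum : Summable fun h : ℤ => tailCoeff P X {0, h})
    {u : ℕ → ℝ} (hu : Tendsto u atTop atTop)
    (hnp : Tendsto (fun n : ℕ => (n : ℝ) * exceedProb P X (u n)) atTop atTop) :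
    TendstoInMeasure P (fun (n : ℕ) (ω : Ω) => exceedCount X (u n) (Finset.Icc 1 n) ω /
      ((n : ℝ) * exceedProb P X (u n))) atTop fun _ => 1 := by
  rw [tendstoInMeasure_iff_measureReal_norm]
  intro ε hε
  set S := ∑' h : ℤ, tailCoeff P X {0, h} with hS
  have hS0 : 0 ≤ S := tsum_nonneg fun h =>
    tailCoeff_nonneg hX hα hmax hmarg (Finset.insert_nonempty _ _)
  have hlim : Tendsto (fun n : ℕ => 2 * S / ε ^ 2 * ((n : ℝ) * exceedProb P X (u n))⁻¹) atTop
      (𝓝 0) := by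
    have := (tendsto_inv_atTop_zero.comp hnp).const_mul (2 * S / ε ^ 2)
    rwa [mul_zero] at this
  refine squeeze_zero' (Eventually.of_forall fun _ => measureReal_nonneg) ?_ hlim
  filter_upwards [hu.eventually_ge_atTop 1, hnp.eventually_gt_atTop 0] with n hu1 hn
  have hu0 : 0 < u n := one_pos.trans_le hu1
  set x := u n ^ (-α) with hx
  have hx0 : 0 < x := Real.rpow_pos_of_pos hu0 _
  have hx1 : x ≤ 1 := Real.rpow_le_one_of_one_le_of_nonpos hu1 (neg_nonpos.2 hα.le)
  have hux : u n = x ^ (-1 / α) := (rpow_rpow_level hα hu0).symm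
  have hp : x / 2 ≤ exceedProb P X (u n) := by
    rw [hux, exceedProb_level hX hα hmarg hx0]
    exact half_le_one_sub_exp hx0 hx1
  have hp0 : 0 < exceedProb P X (u n) := by linarith
  set a := (n : ℝ) * exceedProb P X (u n) with ha
  have hmean : ∫ ω, exceedCount X (u n) (Finset.Icc 1 n) ω ∂P = a := by
    rw [integral_exceedCount hX hstat hp0.ne']
    simp [ha]
  have hvar := variance_exceedCount_le hX hα hstat hmax hmarg hsum hx0 (Finset.Icc 1 n)
  rw [← hux, Nat.card_Icc, Nat.add_sub_cancel] at hvar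
  have hcheb := meas_ge_le_variance_div_sq (μ := P)
    (memLp_exceedCount hX (u n) (Finset.Icc 1 n)) (c := ε * a) (by positivity)
  rw [hmean] at hcheb
  have hset : {ω | ε ≤ ‖exceedCount X (u n) (Finset.Icc 1 n) ω / a - 1‖} =
      {ω | ε * a ≤ |exceedCount X (u n) (Finset.Icc 1 n) ω - a|} := by
    ext ω
    simp only [Set.mem_ofPred_eq]
    rw [div_sub_one hn.ne', Real.norm_eq_abs, abs_div, abs_of_pos hn, le_div_iff₀ hn]
  rw [hset, measureReal_def]
  refine (ENNReal.toReal_le_of_le_ofReal (div_nonneg (variance_nonneg _ _) (sq_nonneg _))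
    hcheb).trans ?_
  rw [div_le_iff₀ (by positivity)]
  calc _ ≤ x * (n * S) := hvar
    _ ≤ (2 * exceedProb P X (u n)) * (n * S) :=
        mul_le_mul_of_nonneg_right (by linarith) (by positivity)
    _ = 2 * S / ε ^ 2 * a⁻¹ * (ε * a) ^ 2 := by
        rw [ha]
        have : (n : ℝ) ≠ 0 := fun h => by simp [ha, h] at hn
        field_simp

end LLN

/-! ### The ratio estimator -/

section Estimator

variable {Ω : Type*} {X : ℤ → Ω → ℝ} {α : ℝ} {T : Finset ℤ}

lemma mem_jointSet_iff {u : ℝ} (hu : 0 < u) {ω : Ω} (hω : ∀ j, 0 < X j ω) (t : ℤ) :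
    u⁻¹ • obsWindow X T t ω ∈ jointSet T ↔ ∀ j ∈ T.image fun s => t + s, u < X j ω := by
  simp only [jointSet, obsWindow, Set.mem_ofPred_eq, Pi.smul_apply, smul_eq_mul,
    inv_mul_eq_div, one_lt_div hu, Subtype.forall, Finset.forall_mem_image]
  exact and_iff_right fun s _ => div_pos (hω _) hu

lemma mem_baseSet_iff (hT0 : (0 : ℤ) ∈ T) {u : ℝ} (hu : 0 < u) {ω : Ω} (hω : ∀ j, 0 < X j ω)
    (t : ℤ) :
    u⁻¹ • obsWindow X T t ω ∈ baseSet T ↔ ∀ j ∈ ({t} : Finset ℤ), u < X j ω := by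
  simp only [baseSet, obsWindow, Set.mem_ofPred_eq, Pi.smul_apply, smul_eq_mul,
    inv_mul_eq_div, one_lt_div hu, Subtype.forall, Finset.mem_singleton, forall_eq]
  rw [and_iff_right fun s _ => div_pos (hω _) hu]
  exact ⟨fun h => by simpa using h 0 hT0 rfl, fun h s _ hs => by simpa [hs] using h⟩

lemma relFreq_jointSet_eq {u : ℝ} (hu : 0 < u) {ω : Ω} (hω : ∀ j, 0 < X j ω) (n : ℕ) :
    relFreq X T (jointSet T) u n ω = 1 / (n : ℝ) * ∑ t ∈ Finset.Icc 1 n,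
      allExceed u (fun j => X j ω) (T.image fun s => (t : ℤ) + s) := by
  rw [relFreq]
  congr 1
  refine Finset.sum_congr rfl fun t _ => ?_
  have e := mem_jointSet_iff (T := T) hu hω t
  rw [allExceed]
  split_ifs with h
  · exact Set.indicator_of_mem (M := ℝ) (s := {ω | u⁻¹ • obsWindow X T t ω ∈ jointSet T}) (e.2 h) _
  · exact Set.indicator_of_notMem (M := ℝ) (s := {ω | u⁻¹ • obsWindow X T t ω ∈ jointSet T})
      (fun hm => h (e.1 hm)) _

lemma relFreq_baseSet_eq (hT0 : (0 : ℤ) ∈ T) {u : ℝ} (hu : 0 < u) {ω : Ω}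
    (hω : ∀ j, 0 < X j ω) (n : ℕ) :
    relFreq X T (baseSet T) u n ω = 1 / (n : ℝ) * exceedCount X u (Finset.Icc 1 n) ω := by
  rw [relFreq, exceedCount]
  congr 1
  refine Finset.sum_congr rfl fun t _ => ?_
  have e := mem_baseSet_iff hT0 hu hω t
  rw [allExceed]
  split_ifs with h
  · exact Set.indicator_of_mem (M := ℝ) (s := {ω | u⁻¹ • obsWindow X T t ω ∈ baseSet T}) (e.2 h) _
  · exact Set.indicator_of_notMem (M := ℝ) (s := {ω | u⁻¹ • obsWindow X T t ω ∈ baseSet T})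
      (fun hm => h (e.1 hm)) _

/-- The estimation error is the centred numerator divided by the number of exceedances. -/
lemma chiHat_sub_eq (hT0 : (0 : ℤ) ∈ T) {u : ℝ} (hu : 0 < u) {ω : Ω} (hω : ∀ j, 0 < X j ω)
    {n : ℕ} (hN : exceedCount X u (Finset.Icc 1 n) ω ≠ 0) (π : ℝ) :
    chiHat X T u n ω - π = (∑ t ∈ Finset.Icc 1 n, score T u π t fun j => X j ω) /
      exceedCount X u (Finset.Icc 1 n) ω := by
  have hn : (n : ℝ) ≠ 0 := by
    rintro h
    have : n = 0 := by exact_mod_cast h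
    subst this
    simp [exceedCount] at hN
  have hs : ∑ t ∈ Finset.Icc 1 n, score T u π t (fun j => X j ω) =
      ∑ t ∈ Finset.Icc 1 n, allExceed u (fun j => X j ω) (T.image fun s => (t : ℤ) + s) -
        π * exceedCount X u (Finset.Icc 1 n) ω := by
    simp only [score, exceedCount, Finset.sum_sub_distrib, Finset.mul_sum]
  rw [hs, sub_div, mul_div_cancel_right₀ _ hN, chiHat, relFreq_jointSet_eq hu hω,
    relFreq_baseSet_eq hT0 hu hω, mul_div_mul_left _ _ (one_div_ne_zero hn)]

variable [MeasurableSpace Ω] {P : Measure Ω}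

lemma measurableSet_jointSet : MeasurableSet (jointSet T) := by
  have : jointSet T = (⋂ s : T, {x | 0 < x s}) ∩ ⋂ s : T, {x | 1 < x s} := by
    ext x; simp [jointSet]
  rw [this]
  exact (MeasurableSet.iInter fun s =>
    measurableSet_lt measurable_const (measurable_pi_apply s)).inter
    (MeasurableSet.iInter fun s => measurableSet_lt measurable_const (measurable_pi_apply s))

lemma measurableSet_baseSet : MeasurableSet (baseSet T) := by
  have : baseSet T = (⋂ s : T, {x | 0 < x s}) ∩ ⋂ s : T, ⋂ _ : (s : ℤ) = 0, {x | 1 < x s} := by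
    ext x; simp [baseSet]
  rw [this]
  exact (MeasurableSet.iInter fun s =>
    measurableSet_lt measurable_const (measurable_pi_apply s)).inter
    (MeasurableSet.iInter fun s => MeasurableSet.iInter fun _ =>
      measurableSet_lt measurable_const (measurable_pi_apply s))

lemma measurable_relFreq (hX : ∀ t, Measurable (X t)) {C : Set (T → ℝ)} (hC : MeasurableSet C)
    (u : ℝ) (n : ℕ) : Measurable (relFreq X T C u n) := by
  refine (Finset.measurable_fun_sum _ fun t _ => measurable_const.indicator ?_).const_mul _
  have hw : Measurable fun ω => u⁻¹ • obsWindow X T t ω :=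
    measurable_pi_lambda _ fun s => (hX _).const_mul _
  exact hw hC

lemma measurable_chiHat (hX : ∀ t, Measurable (X t)) (u : ℝ) (n : ℕ) :
    Measurable (chiHat X T u n) :=
  (measurable_relFreq hX measurableSet_jointSet u n).div
    (measurable_relFreq hX measurableSet_baseSet u n)

variable [IsProbabilityMeasure P]

lemma ae_forall_pos (hα : 0 < α) (hmarg : HasFrechetMargins P X α) :
    ∀ᵐ ω ∂P, ∀ j, 0 < X j ω := by
  rw [ae_all_iff]
  intro j
  have h := measureReal_le_eq_zero hα hmarg j le_rfl
  rw [measureReal_eq_zero_iff] at h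
  simpa [ae_iff] using h

lemma chiCentering_eq (hα : 0 < α) (hmarg : HasFrechetMargins P X α) (hT0 : (0 : ℤ) ∈ T) {u : ℝ}
    (hu : 0 < u) : chiCentering P X T u = tailRatio P X T u := by
  rw [chiCentering, tailRatio, exceedProb]
  congr 1 <;> refine measureReal_congr ?_ <;>
    filter_upwards [ae_forall_pos hα hmarg] with ω hω <;> refine propext ?_
  · change u⁻¹ • obsWindow X T 0 ω ∈ jointSet T ↔ ∀ t ∈ T, u < X t ω
    simpa using mem_jointSet_iff (T := T) hu hω 0
  · change u⁻¹ • obsWindow X T 0 ω ∈ baseSet T ↔ u < X 0 ω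
    simpa using mem_baseSet_iff hT0 hu hω 0

/-- A sequence of random variables that is dominated by a null sequence of constants outside events
of vanishing probability tends to `0` in probability. -/
lemma tendstoInMeasure_zero_of_abs_le {f : ℕ → Ω → ℝ} {c : ℕ → ℝ} {B : ℕ → Set Ω}
    (hc : Tendsto c atTop (𝓝 0)) (hB : Tendsto (fun n => P.real (B n)) atTop (𝓝 0))
    (hf : ∀ᶠ n in atTop, ∀ᵐ ω ∂P, ω ∉ B n → |f n ω| ≤ c n) :
    TendstoInMeasure P f atTop 0 := by
  rw [tendstoInMeasure_iff_measureReal_norm]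
  intro ε hε
  refine squeeze_zero' (Eventually.of_forall fun _ => measureReal_nonneg) ?_ hB
  filter_upwards [hf, hc.eventually_lt_const hε] with n hn hcn
  refine ENNReal.toReal_mono (measure_ne_top _ _) (measure_mono_ae ?_)
  filter_upwards [hn] with ω hω (hε' : ε ≤ ‖f n ω - (0 : Ω → ℝ) ω‖)
  by_contra hB'
  have h1 := hω hB'
  rw [Pi.zero_apply, sub_zero, Real.norm_eq_abs] at hε'
  linarith

/-- Asymptotic normality of the ratio estimator with pre-asymptotic centring. -/
theorem tendstoInDistribution_chiHat_sub_chiCentering (hX : ∀ t, Measurable (X t)) (hα : 0 < α)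
    (hstat : IsStationarySeries P X)
    (hmax : IsMaxStableSeries P X) (hmarg : HasFrechetMargins P X α)
    (hsum : Summable fun h : ℤ => tailCoeff P X {0, h}) (hT0 : (0 : ℤ) ∈ T)
    {u : ℕ → ℝ} (hu : Tendsto u atTop atTop)
    (hnp : Tendsto (fun n : ℕ => (n : ℝ) * exceedProb P X (u n)) atTop atTop) {σ2 : ℝ≥0}
    (hσ : HasSum (varTerm P X T) (σ2 : ℝ)) :
    TendstoInDistribution (fun (n : ℕ) (ω : Ω) => √((n : ℝ) * exceedProb P X (u n)) *
        (chiHat X T (u n) n ω - chiCentering P X T (u n)))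
      atTop (id : ℝ → ℝ) (fun _ => P) (gaussianReal 0 σ2) := by
  set R : ℕ → Ω → ℝ := fun n ω => exceedCount X (u n) (Finset.Icc 1 n) ω /
    ((n : ℝ) * exceedProb P X (u n)) with hR
  have hR1 : TendstoInMeasure P R atTop fun _ => 1 :=
    tendstoInMeasure_exceedCount_div hX hα hstat hmax hmarg hsum hu hnp
  -- the denominator is truncated at `1/2` to make the quotient continuous
  have hg : Continuous fun z : ℝ × ℝ => z.1 / max z.2 (1 / 2) :=
    continuous_fst.div (continuous_snd.max continuous_const) fun z =>
      (lt_max_of_lt_right (by norm_num : (0 : ℝ) < 1 / 2)).ne'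
  have hslut := (tendstoInDistribution_sum_score hX hα hstat hmax hmarg hsum hT0 hu hnp
    hσ).continuous_comp_prodMk_of_tendstoInMeasure_const hg hR1
      fun n => ((measurable_exceedCount hX _ _).div_const _).aemeasurable
  have hid : (fun ω : ℝ => (fun z : ℝ × ℝ => z.1 / max z.2 (1 / 2)) ((id : ℝ → ℝ) ω, (1 : ℝ))) =
      (id : ℝ → ℝ) := by
    ext ω
    simp only [id]
    rw [max_eq_left (by norm_num), div_one]
  rw [hid] at hslut
  refine tendstoInDistribution_of_tendstoInMeasure_sub _ _ hslut ?_ fun n =>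
    (((measurable_chiHat hX _ _).sub_const _).const_mul _).aemeasurable
  have hB := tendstoInMeasure_iff_measureReal_norm.1 hR1 (1 / 2) (by norm_num)
  refine tendstoInMeasure_zero_of_abs_le tendsto_const_nhds hB ?_
  filter_upwards [hu.eventually_gt_atTop 0, hnp.eventually_gt_atTop 0] with n hun hn
  filter_upwards [ae_forall_pos hα hmarg] with ω hω hωB
  have hRω : 1 / 2 ≤ R n ω := by
    have h1 : ‖R n ω - 1‖ < 1 / 2 := not_le.1 hωB
    rw [Real.norm_eq_abs, abs_lt] at h1
    linarith
  have hN : exceedCount X (u n) (Finset.Icc 1 n) ω ≠ 0 := by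
    intro h
    simp only [hR, h, zero_div] at hRω
    norm_num at hRω
  refine le_of_eq (abs_eq_zero.2 ?_)
  simp only [Pi.sub_apply]
  rw [max_eq_left hRω, chiCentering_eq hα hmarg hT0 hun, chiHat_sub_eq hT0 hun hω hN, sub_eq_zero]
  have hsq := Real.sq_sqrt hn.le
  have hs0 : √((n : ℝ) * exceedProb P X (u n)) ≠ 0 := (Real.sqrt_pos.2 hn).ne'
  simp only [hR]
  rw [← hsq]
  rw [Real.sqrt_sq (Real.sqrt_nonneg _)]
  field_simp

/-- The bias of the pre-asymptotic centring is of the order of the exceedance probability, hence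
negligible when `n * p ^ 3` tends to `0`. -/
lemma tendsto_sqrt_mul_chiCentering_sub (hX : ∀ t, Measurable (X t)) (hα : 0 < α)
    (hmax : IsMaxStableSeries P X) (hmarg : HasFrechetMargins P X α) (hT0 : (0 : ℤ) ∈ T)
    {u : ℕ → ℝ} (hu : Tendsto u atTop atTop)
    (hnp3 : Tendsto (fun n : ℕ => (n : ℝ) * exceedProb P X (u n) ^ 3) atTop (𝓝 0)) :
    Tendsto (fun n : ℕ => √((n : ℝ) * exceedProb P X (u n)) *
      (chiCentering P X T (u n) - tailCoeff P X T)) atTop (𝓝 0) := by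
  obtain ⟨K, hK⟩ := exists_abs_tailRatio_sub_le hX hα hmax hmarg (S := T) ⟨0, hT0⟩
  have hlim : Tendsto (fun n : ℕ => 2 * |K| * √((n : ℝ) * exceedProb P X (u n) ^ 3)) atTop
      (𝓝 0) := by
    have h := ((Real.continuous_sqrt.tendsto 0).comp hnp3).const_mul (2 * |K|)
    rwa [Real.sqrt_zero, mul_zero] at h
  refine squeeze_zero_norm' ?_ hlim
  filter_upwards [hu.eventually_ge_atTop 1] with n hu1
  have hu0 : 0 < u n := one_pos.trans_le hu1
  set x := u n ^ (-α) with hx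
  have hx0 : 0 < x := Real.rpow_pos_of_pos hu0 _
  have hx1 : x ≤ 1 := Real.rpow_le_one_of_one_le_of_nonpos hu1 (neg_nonpos.2 hα.le)
  have hux : u n = x ^ (-1 / α) := (rpow_rpow_level hα hu0).symm
  have hp : x / 2 ≤ exceedProb P X (u n) := by
    rw [hux, exceedProb_level hX hα hmarg hx0]
    exact half_le_one_sub_exp hx0 hx1
  have hp0 : 0 < exceedProb P X (u n) := by linarith
  have h1 := hK x hx0 hx1
  rw [← hux] at h1
  have h2 : |chiCentering P X T (u n) - tailCoeff P X T| ≤ 2 * |K| * exceedProb P X (u n) := by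
    rw [chiCentering_eq hα hmarg hT0 hu0]
    refine h1.trans ?_
    nlinarith [le_abs_self K, abs_nonneg K]
  have h3 : √((n : ℝ) * exceedProb P X (u n) ^ 3) =
      √((n : ℝ) * exceedProb P X (u n)) * exceedProb P X (u n) := by
    have : (n : ℝ) * exceedProb P X (u n) ^ 3 =
        (n * exceedProb P X (u n)) * exceedProb P X (u n) ^ 2 := by ring
    rw [this, Real.sqrt_mul (by positivity), Real.sqrt_sq hp0.le]
  rw [norm_mul, Real.norm_of_nonneg (Real.sqrt_nonneg _), Real.norm_eq_abs, h3]
  calc _ ≤ √((n : ℝ) * exceedProb P X (u n)) * (2 * |K| * exceedProb P X (u n)) :=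
        mul_le_mul_of_nonneg_left h2 (Real.sqrt_nonneg _)
    _ = _ := by ring

end Estimator
/-! ### Asymptotic normality -/

theorem mainTheorem1 {Ω : Type*} [MeasurableSpace Ω] (P : Measure Ω) [IsProbabilityMeasure P]
    (X : ℤ → Ω → ℝ) (hX : ∀ t, Measurable (X t))
    (α : ℝ) (hα : 0 < α)
    (hstat : IsStationarySeries P X)
    (hmax : IsMaxStableSeries P X)
    (hmarg : HasFrechetMargins P X α)
    (hsum : Summable (fun t : ℕ => 2 - extremalCoeff P X {0, (t : ℤ) + 1}))
    (T : Finset ℤ) (hT0 : (0 : ℤ) ∈ T) (hT : ∀ t ∈ T, 0 ≤ t) :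
    -- the tail dependence coefficients exist as limits
    (∀ S : Finset ℤ, S.Nonempty →
      Tendsto (tailRatio P X S) atTop (𝓝 (tailCoeff P X S))) ∧
    ∃ σ2 : ℝ≥0, HasSum (varTerm P X T) (σ2 : ℝ) ∧
      ∀ u : ℕ → ℝ, Tendsto u atTop atTop →
        Tendsto (fun n : ℕ => (n : ℝ) * exceedProb P X (u n)) atTop atTop →
        TendstoInDistribution
          (fun (n : ℕ) (ω : Ω) => √((n : ℝ) * exceedProb P X (u n)) *
            (chiHat X T (u n) n ω - chiCentering P X T (u n)))
          atTop (id : ℝ → ℝ) (fun _ => P) (gaussianReal 0 σ2) ∧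
        (Tendsto (fun n : ℕ => (n : ℝ) * exceedProb P X (u n) ^ 3) atTop (𝓝 0) →
          TendstoInDistribution
            (fun (n : ℕ) (ω : Ω) => √((n : ℝ) * exceedProb P X (u n)) *
              (chiHat X T (u n) n ω - tailCoeff P X T))
            atTop (id : ℝ → ℝ) (fun _ => P) (gaussianReal 0 σ2)) := by
  have hχ := summable_tailCoeff_pair hX hα hstat hmax hmarg hsum
  have hσ0 := tsum_varTerm_nonneg hX hα hstat hmax hmarg hχ hT0
  obtain ⟨σ2, hσ2⟩ : ∃ σ2 : ℝ≥0, (σ2 : ℝ) = ∑' h, varTerm P X T h := ⟨⟨_, hσ0⟩, rfl⟩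
  have hσ : HasSum (varTerm P X T) (σ2 : ℝ) :=
    hσ2 ▸ (summable_varTerm hX hα hmax hmarg hχ hT0).hasSum
  refine ⟨fun S hS => tendsto_tailRatio hX hα hmax hmarg hS, σ2, hσ, fun u hu hnp => ?_⟩
  have hclt := tendstoInDistribution_chiHat_sub_chiCentering hX hα hstat hmax hmarg hχ hT0 hu hnp hσ
  refine ⟨hclt, fun hnp3 => ?_⟩
  have hbias := (tendsto_sqrt_mul_chiCentering_sub hX hα hmax hmarg hT0 hu hnp3).abs
  rw [abs_zero] at hbias
  refine tendstoInDistribution_of_tendstoInMeasure_sub _ _ hclt ?_ fun n =>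
    (((measurable_chiHat hX _ _).sub_const _).const_mul _).aemeasurable
  refine tendstoInMeasure_zero_of_abs_le (B := fun _ => ∅)
    hbias (by simp)
    (Eventually.of_forall fun n => ae_of_all _ fun ω _ => le_of_eq ?_)
  simp only [Pi.sub_apply]
  congr 1
  ring
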